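/- Let $p$ denote a prime. A matrix $B\in\mathbb F_p^{m\times n}$ with $n\le m$ is an MDS generator matrix if any $n$ of its rows are linearly independent. For sets $S_1,\dots,S_m\subseteq\mathbb F_p$ and $x\in\mathbb F_p^n$, let $$s(x)=\frac1m\bigl|\{i\in\{1,\dots,m\}:(Bx)_i\in S_i\}\bigr| .$$ Let $H(x)=-x\log x-(1-x)\log(1-x)$ (natural logarithm, $H(0)=H(1)=0$), let $\mathrm{SCL}_{1/2}(\alpha)=\bigl(\sqrt{\alpha/2}+\sqrt{(1-\alpha)/2}\bigr)^2=\tfrac12+\sqrt{\alpha(1-\alpha)}$ for $0\le\alpha\le\tfrac12$, and put $$E(\mu,\delta)=(\mu+\delta)H\Bigl(\frac{\mu}{\mu+\delta}\Bigr)+(1-\mu-\delta)H\Bigl(\frac{\mu}{1-\mu-\delta}\Bigr)-H(2\mu),$$ $$F(\mu)=(1-2\mu)\log 2+(6\mu-2)\log\Bigl(\frac2\pi\Bigr).$$ Fix $\mu$ with $2\mu\in[0,1]$. (i) Let $\delta\in[0,\tfrac12-\mu]$ satisfy $E(\mu,\delta)+F(\mu)<0$. Then, as $m,n\to\infty$ with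 $n/m=2\mu$, for every prime $p$, every MDS generator matrix $B\in\mathbb F_p^{m\times n}$ and all sets $S_1,\dots,S_m\subseteq\mathbb F_p$ with $|S_i|/p\sim\tfrac12$ uniformly in $i$, there is $x\in\mathbb F_p^n$ with $$s(x)\ \ge\ \mathrm{SCL}_{1/2}(\mu+\delta)-o(1).$$ Precisely: for every $\varepsilon>0$ there are $\eta>0$ and $M$, depending only on $\mu,\delta,\varepsilon$, such that whenever $m\ge M$, $n=2\mu m$, $p$ is prime, $B\in\mathbb F_p^{m\times n}$ is an MDS generator matrix and $\bigl||S_i|/p-\tfrac12\bigr|\le\eta$ for all $i$, there is $x\in\mathbb F_p^n$ with $s(x)\ge\mathrm{SCL}_{1/2}(\mu+\delta)-\varepsilon$. (ii) If $2\mu\ge 0.78$, then in the same setting and in the same sense there is $x\in\mathbb F_p^n$ with $s(x)\ge 1-o(1)$. -/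

import Mathlib

noncomputable section

/-- `B` generates an MDS code of length `m` and dimension `n` (the column span of `B`):
any `n` rows of `B` are linearly independent. -/
def IsMDSGenerator {m n p : ℕ} (B : Matrix (Fin m) (Fin n) (ZMod p)) : Prop :=
  n ≤ m ∧ ∀ T : Finset (Fin m), T.card = n →
    LinearIndependent (ZMod p) (fun i : {i : Fin m // i ∈ T} => B i.1)

/-- The satisfaction ratio `s(x)` of `x` in the Max-LINSAT instance given by the matrix `B` and the
input lists `S 1, …, S m`: the fraction of the indices `i` with `(B x)_i ∈ S i`. -/
def satRatio {m n p : ℕ} (B : Matrix (Fin m) (Fin n) (ZMod p)) (S : Fin m → Finset (ZMod p))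
    (x : Fin n → ZMod p) : ℝ :=
  ((Finset.univ.filter (fun i : Fin m => B.mulVec x i ∈ S i)).card : ℝ) / (m : ℝ)

/-- The semicircle law `SCL_ρ(μ)`. -/
def scl (ρ μ : ℝ) : ℝ :=
  if μ + ρ ≤ 1 then (Real.sqrt (μ * (1 - ρ)) + Real.sqrt (ρ * (1 - μ))) ^ 2 else 1

/-- The exponent `E(μ, δ)`; `Real.binEntropy` is the binary entropy with natural logarithms. -/
def expE (μ δ : ℝ) : ℝ :=
  (μ + δ) * Real.binEntropy (μ / (μ + δ))
    + (1 - μ - δ) * Real.binEntropy (μ / (1 - μ - δ)) - Real.binEntropy (2 * μ)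

/-- The exponent `F(μ)`. -/
def expF (μ : ℝ) : ℝ :=
  (1 - 2 * μ) * Real.log 2 + (6 * μ - 2) * Real.log (2 / Real.pi)

/-- Every balanced MDS Max-LINSAT instance of rate `n / m = 2 μ` over a prime field has a solution
`x` with `s(x) ≥ α - o(1)`, as `m → ∞` and `|S i| / p → 1/2` uniformly in `i`.  The error term
is uniform in the prime `p`, the matrix `B` and the lists `S`. -/
def BalancedSolvable (μ α : ℝ) : Prop :=
  ∀ ε : ℝ, 0 < ε → ∃ η : ℝ, 0 < η ∧ ∃ M : ℕ,
    ∀ (m n p : ℕ) [Fact p.Prime] (B : Matrix (Fin m) (Fin n) (ZMod p))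
      (S : Fin m → Finset (ZMod p)),
      M ≤ m → (n : ℝ) = 2 * μ * (m : ℝ) → IsMDSGenerator B →
      (∀ i, |((S i).card : ℝ) / (p : ℝ) - 1 / 2| ≤ η) →
      ∃ x : Fin n → ZMod p, α - ε ≤ satRatio B S x

end

/-!
The proof is by contradiction, through a weighted average of the number of satisfied constraints
over a random codeword `B x`, with a nonnegative polynomial weight.

**Balanced spins.** The lists have density only close to `1/2`, so each coordinate of the codeword
is turned into a random sign whose conditional mean `balancedSign (S i)` is a multiple of
`1_S - ρ`. The sign vector `σ` then has mean zero exactly in each coordinate, while `σ_i = 1` and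
`(B x)_i ∉ S_i` happen together with probability at most `2 η`. More than `ε m / 4` such flips
have probability at most `2 ^ m (2 η) ^ (ε m / 4)`, which for small `η` beats any weight of size
`2 ^ m` (`sum_spinWeight_mul_sign_le`).

**Moments.** The moment of `σ` at a set `T` is a sum over dual codewords supported exactly on `T`
(`codeMoment_eq`). Nonzero dual words have weight above `n`, so the moments with `1 ≤ |T| ≤ n`
vanish, as for uniform signs. The remaining moments have total mass at most
`2 ^ (m - n) g ^ (3 n - 2 m)` with `g ≈ 2 / π`, which is `exp (m F(μ))`
(`IsMDSGenerator.sum_dual_le`): Cauchy–Schwarz and Parseval deal with two disjoint sets of `m - n`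
coordinates, each of which determines the dual word, and each further nonzero coordinate gains a
factor `g`, the bound for a nontrivial Fourier coefficient (`norm_fourierHat_balancedSign_le`).
That bound needs `p` large, and an MDS code of codimension at least two has `p > n`
(`IsMDSGenerator.lt_prime`).

**The polynomial.** The weight is the square of `∑ A, a |A| σ_A`, where `a` is supported on the
`W + 1` layers `l - W, …, l` with `l ≈ (μ + δ) m` and normalises each layer. Under uniform signs
the average of `∑ σ_i` against this weight is about `2 √(α (1 - α)) m` with `α = μ + δ`, for `W`
large, and this is the semicircle law (`le_sum_sqCoeff_layerWeight_singleton`). The coefficients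
of the weight at `|T| ≥ n` are bounded through the generating function
`(1 + y ^ 2) ^ m (2 y / (1 + y ^ 2)) ^ |T|` (`sqCoeff_le`), which decreases in `|T|`; at the
optimal `y` and divided by the binomial coefficient `m.choose l` this is `exp (m E(μ, δ))`. Hence
the moments of the code change the averages by a relative error `exp (m (E + F + o(1)))`, which
tends to zero. A negative exponent also forces `6 μ > 2`, so that `3 n > 2 m`
(`two_lt_of_exponent_neg`).

The second part is the case `δ = 1/2 - μ` of the first, where `E = 0` and the semicircle law gives
`1`.
-/

/-! ### Walsh expansions on the cube -/

section Spin

/-- The Walsh character `σ_T = ∏_{i ∈ T} σ_i`, where `true` stands for the spin `+1` and `false`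
for the spin `-1`. -/
noncomputable def walsh {ι : Type*} (σ : ι → Bool) (T : Finset ι) : ℝ :=
  ∏ i ∈ T, (if σ i then (1 : ℝ) else -1)

variable {ι : Type*} [Fintype ι] [DecidableEq ι]

open Finset

theorem walsh_eq_prod_univ (σ : ι → Bool) (T : Finset ι) :
    walsh σ T = ∏ i, if i ∈ T then (if σ i then (1 : ℝ) else -1) else 1 := by
  rw [walsh, Finset.prod_ite_mem, Finset.univ_inter]

theorem walsh_mul (σ : ι → Bool) (A B : Finset ι) :
    walsh σ A * walsh σ B = walsh σ (symmDiff A B) := by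
  rw [walsh_eq_prod_univ, walsh_eq_prod_univ, walsh_eq_prod_univ, ← Finset.prod_mul_distrib]
  refine Finset.prod_congr rfl fun i _ => ?_
  by_cases hA : i ∈ A <;> by_cases hB : i ∈ B <;> cases σ i <;> simp [Finset.mem_symmDiff, hA, hB]

theorem sum_prod_mul_walsh (h : ι → ℝ) (T : Finset ι) :
    ∑ σ : ι → Bool, (∏ i, (1 + (if σ i then (1 : ℝ) else -1) * h i) / 2) * walsh σ T
      = ∏ i ∈ T, h i := by
  have := Finset.prod_univ_sum (fun _ : ι => (univ : Finset Bool))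
    (fun i b => ((1 + (if b then (1 : ℝ) else -1) * h i) / 2) *
      (if i ∈ T then (if b then (1 : ℝ) else -1) else 1))
  rw [Fintype.piFinset_univ] at this
  simp_rw [walsh_eq_prod_univ, ← Finset.prod_mul_distrib]
  rw [← this, ← Finset.univ_inter T, ← Finset.prod_ite_mem]
  refine Finset.prod_congr rfl fun i _ => ?_
  by_cases hi : i ∈ T <;> simp [hi] <;> ring

/-- The coefficient of `σ_T` in the square of the symmetric polynomial `∑ A, a |A| σ_A`. -/
noncomputable def sqCoeff (a : ℕ → ℝ) (T : Finset ι) : ℝ :=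
  ∑ A : Finset ι, a A.card * a (symmDiff A T).card

/-- The symmetric multilinear polynomial `∑ A, a |A| σ_A`. -/
noncomputable def symPoly (a : ℕ → ℝ) (σ : ι → Bool) : ℝ :=
  ∑ A : Finset ι, a A.card * walsh σ A

theorem symPoly_sq (a : ℕ → ℝ) (σ : ι → Bool) :
    symPoly a σ ^ 2 = ∑ T : Finset ι, sqCoeff a T * walsh σ T := by
  rw [symPoly, sq, Finset.sum_mul_sum]
  simp only [sqCoeff, Finset.sum_mul]
  conv_rhs => rw [Finset.sum_comm]
  refine Finset.sum_congr rfl fun A _ => ?_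
  refine Finset.sum_bij' (fun B _ => symmDiff A B) (fun B _ => symmDiff A B)
    (by simp) (by simp) (by simp) (by simp) ?_
  intro B _
  rw [symmDiff_symmDiff_cancel_left, ← walsh_mul]
  ring

theorem symPoly_sq_mul_sum (a : ℕ → ℝ) (σ : ι → Bool) :
    symPoly a σ ^ 2 * ∑ i, (if σ i then (1 : ℝ) else -1)
      = ∑ T : Finset ι, (∑ i, sqCoeff a (symmDiff T {i})) * walsh σ T := by
  rw [symPoly_sq, Finset.sum_mul_sum]
  simp_rw [Finset.sum_mul]
  rw [Finset.sum_comm]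
  conv_rhs => rw [Finset.sum_comm]
  refine Finset.sum_congr rfl fun i _ => ?_
  have hi : (if σ i then (1 : ℝ) else -1) = walsh σ {i} := by simp [walsh]
  refine Finset.sum_bij' (fun B _ => symmDiff B {i}) (fun B _ => symmDiff B {i})
    (by simp) (by simp) (by simp) (by simp) ?_
  intro B _
  rw [symmDiff_symmDiff_cancel_right, hi, mul_assoc, walsh_mul]

/-- If `a j ≤ k y ^ j`, the coefficients of the square decay geometrically in `|T|`: the sum of
`y ^ (|A| + |A ∆ T|)` over all `A` factors over the coordinates, giving `2 y` for each coordinate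
in `T` and `1 + y ^ 2` for each coordinate outside `T`. -/
theorem sqCoeff_le {a : ℕ → ℝ} {k y : ℝ} (hy : 0 < y)
    (ha0 : ∀ j, 0 ≤ a j) (ha : ∀ j, a j ≤ k * y ^ j) (T : Finset ι) :
    sqCoeff a T ≤ k ^ 2 * ((1 + y ^ 2) ^ Fintype.card ι * (2 * y / (1 + y ^ 2)) ^ T.card) := by
  have hpow : ∀ A : Finset ι, y ^ A.card = ∏ i, if i ∈ A then y else 1 := by
    intro A; rw [Finset.prod_ite_mem, Finset.univ_inter, Finset.prod_const]
  have h1 : sqCoeff a T ≤ ∑ A : Finset ι, k ^ 2 * (y ^ A.card * y ^ (symmDiff A T).card) := by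
    refine Finset.sum_le_sum fun A _ => ?_
    calc a A.card * a (symmDiff A T).card
        ≤ (k * y ^ A.card) * (k * y ^ (symmDiff A T).card) :=
          mul_le_mul (ha _) (ha _) (ha0 _) ((ha0 _).trans (ha _))
      _ = _ := by ring
  refine h1.trans (le_of_eq ?_)
  rw [← Finset.mul_sum]
  congr 1
  have h2 := Finset.prod_add (fun i => if i ∈ T then y else y ^ 2)
    (fun i => if i ∈ T then y else 1) (univ : Finset ι)
  rw [Finset.powerset_univ] at h2
  have h3 : ∀ A : Finset ι, y ^ A.card * y ^ (symmDiff A T).card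
      = (∏ i ∈ A, if i ∈ T then y else y ^ 2) * ∏ i ∈ univ \ A, if i ∈ T then y else 1 := by
    intro A
    have e1 : (∏ i ∈ A, if i ∈ T then y else y ^ 2)
        = ∏ i, if i ∈ A then (if i ∈ T then y else y ^ 2) else 1 := by
      rw [Finset.prod_ite_mem, Finset.univ_inter]
    have e2 : (∏ i ∈ univ \ A, if i ∈ T then y else 1)
        = ∏ i, if i ∈ univ \ A then (if i ∈ T then y else 1) else 1 := by
      rw [Finset.prod_ite_mem univ (univ \ A), Finset.univ_inter]
    rw [hpow, hpow, e1, e2, ← Finset.prod_mul_distrib, ← Finset.prod_mul_distrib]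
    refine Finset.prod_congr rfl fun i _ => ?_
    by_cases hA : i ∈ A <;> by_cases hT : i ∈ T <;> simp [Finset.mem_symmDiff, hA, hT, sq]
  simp_rw [h3]
  rw [← h2]
  have h4 : ∀ i, ((if i ∈ T then y else y ^ 2) + if i ∈ T then y else 1)
      = (1 + y ^ 2) * if i ∈ T then 2 * y / (1 + y ^ 2) else 1 := by
    intro i
    have : (1 + y ^ 2) ≠ 0 := by positivity
    by_cases hT : i ∈ T <;> simp [hT]
    · field_simp; ring
    · ring
  simp_rw [h4]
  rw [Finset.prod_mul_distrib, Finset.prod_const, Finset.prod_ite_mem, Finset.univ_inter,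
    Finset.prod_const, Finset.card_univ]

theorem sqCoeff_nonneg {a : ℕ → ℝ} (ha0 : ∀ j, 0 ≤ a j) (T : Finset ι) : 0 ≤ sqCoeff a T :=
  Finset.sum_nonneg fun _ _ => mul_nonneg (ha0 _) (ha0 _)

theorem sum_finset_card {κ : Type*} [Fintype κ] (f : ℕ → ℝ) :
    ∑ A : Finset κ, f A.card
      = ∑ j ∈ range (Fintype.card κ + 1), ((Fintype.card κ).choose j : ℝ) * f j := by
  have := Finset.sum_powerset_apply_card f (x := (univ : Finset κ))
  simpa [Finset.powerset_univ, Finset.card_univ, nsmul_eq_mul] using this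

theorem sqCoeff_empty (a : ℕ → ℝ) :
    sqCoeff a (∅ : Finset ι)
      = ∑ j ∈ range (Fintype.card ι + 1), ((Fintype.card ι).choose j : ℝ) * a j ^ 2 := by
  rw [← sum_finset_card (fun j => a j ^ 2)]
  refine Finset.sum_congr rfl fun A _ => ?_
  rw [← Finset.bot_eq_empty, symmDiff_bot, sq]

/-- The constant term of `(∑ i, σ_i) (∑ A, a |A| σ_A) ^ 2`: a pair of neighbouring layers `j`,
`j + 1` is counted from below and from above. -/
theorem sum_sqCoeff_singleton (a : ℕ → ℝ) :
    ∑ i : ι, sqCoeff a ({i} : Finset ι)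
      = 2 * ∑ j ∈ range (Fintype.card ι + 1),
          ((Fintype.card ι).choose j : ℝ) * ((Fintype.card ι - j : ℝ) * (a j * a (j + 1))) := by
  have key : ∀ i : ι, sqCoeff a ({i} : Finset ι)
      = 2 * ∑ A : Finset ι, if i ∈ A then 0 else a A.card * a (A.card + 1) := by
    intro i
    have hsplit : sqCoeff a ({i} : Finset ι)
        = (∑ A : Finset ι, if i ∈ A then 0 else a A.card * a (symmDiff A {i}).card)
        + ∑ A : Finset ι, if i ∈ A then a A.card * a (symmDiff A {i}).card else 0 := by
      rw [← Finset.sum_add_distrib]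
      refine Finset.sum_congr rfl fun A _ => ?_
      by_cases hA : i ∈ A <;> simp [hA]
    have hins : ∀ A : Finset ι, i ∉ A → (symmDiff A {i}).card = A.card + 1 := by
      intro A hA
      have : symmDiff A {i} = insert i A := by
        ext j; by_cases hj : j = i <;> simp [Finset.mem_symmDiff, hj, hA]
      rw [this, Finset.card_insert_of_notMem hA]
    have h1 : (∑ A : Finset ι, if i ∈ A then 0 else a A.card * a (symmDiff A {i}).card)
        = ∑ A : Finset ι, if i ∈ A then 0 else a A.card * a (A.card + 1) := by
      refine Finset.sum_congr rfl fun A _ => ?_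
      by_cases hA : i ∈ A
      · simp [hA]
      · simp [hA, hins A hA]
    have h2 : (∑ A : Finset ι, if i ∈ A then a A.card * a (symmDiff A {i}).card else 0)
        = ∑ A : Finset ι, if i ∈ A then 0 else a A.card * a (A.card + 1) := by
      refine Finset.sum_bij' (fun B _ => symmDiff B {i}) (fun B _ => symmDiff B {i})
        (by simp) (by simp) (by simp) (by simp) ?_
      intro B _
      by_cases hB : i ∈ B
      · have hB' : i ∉ symmDiff B {i} := by simp [Finset.mem_symmDiff, hB]
        have := hins _ hB'
        rw [symmDiff_symmDiff_cancel_right] at this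
        simp only [hB, hB', if_true, if_false]
        rw [← this, mul_comm]
      · have hB' : i ∈ symmDiff B {i} := by simp [Finset.mem_symmDiff, hB]
        simp [hB, hB']
    rw [hsplit, h1, h2]; ring
  simp_rw [key]
  rw [← Finset.mul_sum, Finset.sum_comm]
  congr 1
  rw [← sum_finset_card (fun j => ((Fintype.card ι - j : ℝ) * (a j * a (j + 1))))]
  refine Finset.sum_congr rfl fun A _ => ?_
  rw [Finset.sum_ite, Finset.sum_const_zero, zero_add, Finset.sum_const, nsmul_eq_mul]
  congr 1
  have : (univ.filter fun i => i ∉ A) = Aᶜ := by ext; simp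
  rw [this, Finset.card_compl, Nat.cast_sub (Finset.card_le_univ A)]

theorem symPoly_sq_le (a : ℕ → ℝ) (σ : ι → Bool) :
    symPoly a σ ^ 2 ≤ 2 ^ Fintype.card ι * sqCoeff a (∅ : Finset ι) := by
  have h := Finset.sum_mul_sq_le_sq_mul_sq (univ : Finset (Finset ι))
    (fun A => walsh σ A) (fun A => a A.card)
  have hw : ∀ A : Finset ι, walsh σ A ^ 2 = 1 := by
    intro A; rw [walsh, ← Finset.prod_pow]
    exact Finset.prod_eq_one fun i _ => by cases σ i <;> simp
  simp_rw [hw] at h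
  have e : sqCoeff a (∅ : Finset ι) = ∑ A : Finset ι, a A.card ^ 2 := by
    refine Finset.sum_congr rfl fun A _ => ?_
    rw [← Finset.bot_eq_empty, symmDiff_bot, sq]
  rw [e, symPoly]
  simpa [mul_comm, Fintype.card_finset] using h

/-- A signed weight `D` on the cube whose nonconstant moments `c T` vanish up to order `n` and have
small total mass integrates a polynomial almost as the uniform weight does. -/
theorem abs_sum_moment_sub_le {D : (ι → Bool) → ℝ} {c : Finset ι → ℝ}
    (hc : ∀ T, ∑ σ, D σ * walsh σ T = c T) (hc1 : c ∅ = 1) {n : ℕ}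
    (hcn : ∀ T : Finset ι, T.Nonempty → T.card ≤ n → c T = 0) {C : ℝ}
    (hC : ∑ T ∈ univ.erase (∅ : Finset ι), |c T| ≤ C)
    (f : (ι → Bool) → ℝ) (q : Finset ι → ℝ) (hf : ∀ σ, f σ = ∑ T, q T * walsh σ T) {M : ℝ}
    (hM : 0 ≤ M) (hq : ∀ T : Finset ι, n < T.card → |q T| ≤ M) :
    |∑ σ, D σ * f σ - q ∅| ≤ M * C := by
  have h1 : ∑ σ, D σ * f σ = ∑ T, q T * c T := by
    simp_rw [hf, Finset.mul_sum]
    rw [Finset.sum_comm]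
    refine Finset.sum_congr rfl fun T _ => ?_
    rw [← hc, Finset.mul_sum]
    exact Finset.sum_congr rfl fun σ _ => by ring
  rw [h1, ← Finset.add_sum_erase _ _ (mem_univ (∅ : Finset ι)), hc1, mul_one, add_sub_cancel_left]
  refine (Finset.abs_sum_le_sum_abs _ _).trans (le_trans ?_ (mul_le_mul_of_nonneg_left hC hM))
  rw [Finset.mul_sum]
  refine Finset.sum_le_sum fun T hT => ?_
  rw [abs_mul]
  by_cases hTn : T.card ≤ n
  · rw [hcn T (Finset.nonempty_iff_ne_empty.2 (Finset.ne_of_mem_erase hT)) hTn]; simp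
  · exact mul_le_mul_of_nonneg_right (hq T (not_le.1 hTn)) (abs_nonneg _)

end Spin

/-! ### Fourier analysis on a prime field -/

section Fourier

open Finset

variable {p : ℕ} [Fact p.Prime]

theorem stdAddChar_sum {ι : Type*} (s : Finset ι) (w : ι → ZMod p) :
    (ZMod.stdAddChar (∑ i ∈ s, w i) : ℂ) = ∏ i ∈ s, ZMod.stdAddChar (w i) := by
  classical
  induction s using Finset.induction_on with
  | empty => simp
  | insert i s hi ih =>
    rw [Finset.sum_insert hi, Finset.prod_insert hi, AddChar.map_add_eq_mul, ih]

theorem sum_stdAddChar_mul (b : ZMod p) :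
    ∑ x : ZMod p, (ZMod.stdAddChar (b * x) : ℂ) = if b = 0 then (p : ℂ) else 0 := by
  have := AddChar.sum_mulShift b (ZMod.isPrimitive_stdAddChar p)
  rw [ZMod.card] at this
  simp_rw [mul_comm b]
  rw [this]; split_ifs <;> simp

/-- The normalised Fourier coefficient `p⁻¹ ∑ t, f t exp (-2 π i a t / p)`. -/
noncomputable def fourierHat (f : ZMod p → ℝ) (a : ZMod p) : ℂ :=
  (p : ℂ)⁻¹ * ∑ t, (f t : ℂ) * ZMod.stdAddChar (-(a * t))

theorem fourierHat_inversion (f : ZMod p → ℝ) (x : ZMod p) :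
    (f x : ℂ) = ∑ a, fourierHat f a * ZMod.stdAddChar (a * x) := by
  have hp : (p : ℂ) ≠ 0 := by exact_mod_cast (Fact.out : p.Prime).ne_zero
  simp_rw [fourierHat, mul_assoc, ← Finset.mul_sum, Finset.sum_mul]
  rw [Finset.sum_comm]
  have h : ∀ t : ZMod p, ∑ a : ZMod p, (f t : ℂ) * ZMod.stdAddChar (-(a * t))
      * ZMod.stdAddChar (a * x) = (f t : ℂ) * if x - t = 0 then (p : ℂ) else 0 := by
    intro t
    rw [← sum_stdAddChar_mul, Finset.mul_sum]
    refine Finset.sum_congr rfl fun a _ => ?_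
    rw [mul_assoc, ← AddChar.map_add_eq_mul]
    congr 2; ring
  simp_rw [h, sub_eq_zero]
  simp [hp, mul_comm]

theorem fourierHat_parseval (f : ZMod p → ℝ) :
    ∑ a, ‖fourierHat f a‖ ^ 2 = (p : ℝ)⁻¹ * ∑ t, f t ^ 2 := by
  have hp : (p : ℂ) ≠ 0 := by exact_mod_cast (Fact.out : p.Prime).ne_zero
  have hconj : ∀ a : ZMod p, (starRingEnd ℂ) (fourierHat f a)
      = (p : ℂ)⁻¹ * ∑ t, (f t : ℂ) * ZMod.stdAddChar (a * t) := by
    intro a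
    rw [fourierHat, map_mul, map_sum, map_inv₀, Complex.conj_natCast]
    congr 1
    refine Finset.sum_congr rfl fun t _ => ?_
    rw [map_mul, Complex.conj_ofReal, AddChar.map_neg_eq_conj, Complex.conj_conj]
  have h : ((∑ a, ‖fourierHat f a‖ ^ 2 : ℝ) : ℂ) = (p : ℂ)⁻¹ * ∑ t, (f t : ℂ) ^ 2 := by
    push_cast
    simp_rw [← Complex.mul_conj', hconj, Finset.mul_sum]
    rw [Finset.sum_comm]
    refine Finset.sum_congr rfl fun t _ => ?_
    conv_rhs => rw [sq]; enter [2, 2]; rw [fourierHat_inversion f t]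
    rw [Finset.mul_sum, Finset.mul_sum]
    exact Finset.sum_congr rfl fun a _ => by ring
  apply Complex.ofReal_injective
  rw [h]; push_cast; rfl

theorem sum_stdAddChar_dotProduct {n : ℕ} (v : Fin n → ZMod p) :
    ∑ x : Fin n → ZMod p, (ZMod.stdAddChar (v ⬝ᵥ x) : ℂ) = if v = 0 then (p : ℂ) ^ n else 0 := by
  have h1 : ∀ x : Fin n → ZMod p, (ZMod.stdAddChar (v ⬝ᵥ x) : ℂ)
      = ∏ j, (ZMod.stdAddChar (v j * x j) : ℂ) := by
    intro x
    rw [dotProduct]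
    exact stdAddChar_sum _ _
  have := Finset.prod_univ_sum (fun _ : Fin n => (univ : Finset (ZMod p)))
    (fun j t => (ZMod.stdAddChar (v j * t) : ℂ))
  rw [Fintype.piFinset_univ] at this
  simp_rw [h1]
  rw [← this]
  simp_rw [sum_stdAddChar_mul]
  split_ifs with hv
  · simp [hv]
  · obtain ⟨j, hj⟩ := Function.ne_iff.1 hv
    exact Finset.prod_eq_zero (mem_univ j) (if_neg (by simpa using hj))

/-- Averaging a product function over a linear code picks out the dual codewords. -/
theorem sum_prod_mulVec {m n : ℕ} (B : Matrix (Fin m) (Fin n) (ZMod p)) (f : Fin m → ZMod p → ℝ) :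
    ((∑ x : Fin n → ZMod p, ∏ i, f i (B.mulVec x i) : ℝ) : ℂ)
      = (p : ℂ) ^ n * ∑ y ∈ univ.filter (fun y : Fin m → ZMod p => Matrix.vecMul y B = 0),
          ∏ i, fourierHat (f i) (y i) := by
  push_cast
  have h1 : ∀ x : Fin n → ZMod p, ∏ i, (f i (B.mulVec x i) : ℂ)
      = ∑ y : Fin m → ZMod p, (∏ i, fourierHat (f i) (y i))
          * ZMod.stdAddChar (Matrix.vecMul y B ⬝ᵥ x) := by
    intro x
    simp_rw [fourierHat_inversion (f _) (B.mulVec x _)]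
    rw [Finset.prod_univ_sum, Fintype.piFinset_univ]
    refine Finset.sum_congr rfl fun y _ => ?_
    rw [Finset.prod_mul_distrib, ← Matrix.dotProduct_mulVec, dotProduct]
    congr 1
    exact (stdAddChar_sum _ _).symm
  simp_rw [h1]
  rw [Finset.sum_comm]
  simp_rw [← Finset.mul_sum, sum_stdAddChar_dotProduct]
  rw [Finset.sum_filter, Finset.mul_sum]
  refine Finset.sum_congr rfl fun y _ => ?_
  split_ifs <;> ring

/-- A set of `p`-th roots of unity has a sum of modulus at most `p / π + O(1)`: after a rotation, the
sum is bounded by the sum of the positive parts of the real parts, a Riemann sum of the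
`1`-Lipschitz function `max (cos t) 0`, whose integral over a period is `2`. -/
theorem norm_sum_stdAddChar_le (S : Finset (ZMod p)) :
    ‖∑ t ∈ S, (ZMod.stdAddChar t : ℂ)‖ ≤ p / Real.pi + 2 * Real.pi := by
  have hp0 : (0 : ℝ) < p := by exact_mod_cast (Fact.out : p.Prime).pos
  have hpi := Real.pi_pos
  set v : ℂ := ∑ t ∈ S, (ZMod.stdAddChar t : ℂ) with hv
  set θ : ℝ := Complex.arg v
  set g : ℝ → ℝ := fun t => max (Real.cos t) 0 with hg
  set d : ℝ := 2 * Real.pi / p with hd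
  have hd0 : 0 < d := by positivity
  have hgc : Continuous g := by fun_prop
  have hcosL : ∀ s t : ℝ, Real.cos s - Real.cos t ≤ |s - t| := fun s t =>
    (le_abs_self _).trans (Real.abs_cos_sub_cos_le s t)
  have hgL : ∀ s t : ℝ, g s ≤ g t + |s - t| := by
    intro s t
    refine max_le ?_ (by positivity)
    have := hcosL s t
    have := le_max_left (Real.cos t) 0
    simp only [hg]; linarith
  have hgper : Function.Periodic g (2 * Real.pi) := fun t => by simp [hg]
  have hgint : ∫ t in (-θ)..(-θ + 2 * Real.pi), g t = 2 := by
    rw [hgper.intervalIntegral_add_eq (-θ) (-Real.pi)]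
    have e : (-Real.pi + 2 * Real.pi) = Real.pi := by ring
    rw [e, ← intervalIntegral.integral_add_adjacent_intervals (b := -(Real.pi / 2))
      (hgc.intervalIntegrable _ _) (hgc.intervalIntegrable _ _),
      ← intervalIntegral.integral_add_adjacent_intervals (a := -(Real.pi / 2)) (b := Real.pi / 2)
      (hgc.intervalIntegrable _ _) (hgc.intervalIntegrable _ _)]
    have i1 : ∫ t in (-Real.pi)..(-(Real.pi / 2)), g t
        = ∫ t in (-Real.pi)..(-(Real.pi / 2)), (0:ℝ) := by
      refine intervalIntegral.integral_congr fun t ht => ?_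
      rw [Set.uIcc_of_le (by linarith)] at ht
      refine max_eq_right ?_
      rw [← Real.cos_neg]
      exact Real.cos_nonpos_of_pi_div_two_le_of_le (by linarith [ht.2]) (by linarith [ht.1])
    have i2 : ∫ t in (-(Real.pi / 2))..(Real.pi / 2), g t
        = ∫ t in (-(Real.pi / 2))..(Real.pi / 2), Real.cos t := by
      refine intervalIntegral.integral_congr fun t ht => ?_
      rw [Set.uIcc_of_le (by linarith)] at ht
      exact max_eq_left (Real.cos_nonneg_of_mem_Icc ht)
    have i3 : ∫ t in (Real.pi / 2)..Real.pi, g t = ∫ t in (Real.pi / 2)..Real.pi, (0:ℝ) := by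
      refine intervalIntegral.integral_congr fun t ht => ?_
      rw [Set.uIcc_of_le (by linarith)] at ht
      refine max_eq_right ?_
      exact Real.cos_nonpos_of_pi_div_two_le_of_le (by linarith [ht.1]) (by linarith [ht.2])
    rw [i1, i2, i3, integral_cos]
    simp; norm_num
  have hstep : ∀ k : ℕ, d * g (k * d - θ) - d * d
      ≤ ∫ t in ((k : ℝ) * d - θ)..(((k + 1 : ℕ) : ℝ) * d - θ), g t := by
    intro k
    have hle : (k : ℝ) * d - θ ≤ ((k + 1 : ℕ) : ℝ) * d - θ := by push_cast; linarith
    have := intervalIntegral.integral_mono_on hle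
      (f := fun _ => g (k * d - θ) - d) (g := g) (μ := MeasureTheory.volume) (by simp)
      (hgc.intervalIntegrable _ _) ?_
    · rw [intervalIntegral.integral_const, smul_eq_mul] at this
      push_cast at this ⊢
      linarith
    · intro t ht
      have h1 := hgL (k * d - θ) t
      have h2 : |k * d - θ - t| ≤ d := by
        rw [abs_le]; have := ht.1; have := ht.2; push_cast at *
        constructor <;> linarith
      linarith
  have hsum : d * (∑ k ∈ range p, g (k * d - θ)) ≤ 2 + d * (2 * Real.pi) := by
    have h1 := Finset.sum_le_sum fun k (_ : k ∈ range p) => hstep k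
    rw [intervalIntegral.sum_integral_adjacent_intervals (a := fun k : ℕ => (k : ℝ) * d - θ)
      (fun k _ => hgc.intervalIntegrable _ _)] at h1
    have e1 : ((0 : ℕ) : ℝ) * d - θ = -θ := by simp
    have e2 : (p : ℝ) * d - θ = -θ + 2 * Real.pi := by rw [hd]; field_simp; ring
    rw [e1, e2, hgint, Finset.sum_sub_distrib, ← Finset.mul_sum, Finset.sum_const, card_range,
      nsmul_eq_mul] at h1
    have e3 : (p : ℝ) * (d * d) = d * (2 * Real.pi) := by rw [hd]; field_simp
    linarith
  have hre : ‖v‖ ≤ ∑ k ∈ range p, g (k * d - θ) := by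
    have h1 : (‖v‖ : ℝ) = (v * Complex.exp (-(θ * Complex.I))).re := by
      conv_rhs => rw [← Complex.norm_mul_exp_arg_mul_I v]
      rw [mul_assoc, ← Complex.exp_add]
      simp [θ]
    have h2 : ∀ t : ZMod p, ((ZMod.stdAddChar t : ℂ) * Complex.exp (-(θ * Complex.I))).re
        = Real.cos (t.val * d - θ) := by
      intro t
      rw [ZMod.stdAddChar_apply, ZMod.toCircle_apply, ← Complex.exp_add,
        ← Complex.exp_ofReal_mul_I_re]
      congr 2
      rw [hd]; push_cast; ring
    rw [h1, hv, Finset.sum_mul, Complex.re_sum]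
    simp_rw [h2]
    calc ∑ t ∈ S, Real.cos (t.val * d - θ) ≤ ∑ t ∈ S, g (t.val * d - θ) :=
          Finset.sum_le_sum fun t _ => le_max_left _ _
      _ ≤ ∑ t : ZMod p, g (t.val * d - θ) :=
          Finset.sum_le_sum_of_subset_of_nonneg (subset_univ _) fun _ _ _ => le_max_right _ _
      _ = ∑ k ∈ range p, g (k * d - θ) := by
          refine Finset.sum_bij' (fun t _ => t.val) (fun k _ => (k : ZMod p)) ?_ ?_ ?_ ?_ ?_
          · intro t _; simpa using ZMod.val_lt t
          · intro k _; exact mem_univ _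
          · intro t _; simp
          · intro k hk; simpa using ZMod.val_cast_of_lt (mem_range.1 hk)
          · intro t _; rfl
  have h3 : d * ‖v‖ ≤ d * (p / Real.pi + 2 * Real.pi) := by
    refine (mul_le_mul_of_nonneg_left hre hd0.le).trans (hsum.trans (le_of_eq ?_))
    rw [hd]; field_simp
  exact le_of_mul_le_mul_left h3 hd0

theorem norm_sum_stdAddChar_mul_le (S : Finset (ZMod p)) {a : ZMod p} (ha : a ≠ 0) :
    ‖∑ t ∈ S, (ZMod.stdAddChar (-(a * t)) : ℂ)‖ ≤ p / Real.pi + 2 * Real.pi := by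
  have hinj : Function.Injective fun t : ZMod p => -(a * t) := fun s t h => by
    simpa [ha] using h
  have := norm_sum_stdAddChar_le (S.map ⟨_, hinj⟩)
  rwa [Finset.sum_map] at this

end Fourier

/-! ### Dual words of MDS codes and moments -/

section MDS

open Finset

variable {m n p : ℕ} [Fact p.Prime] {B : Matrix (Fin m) (Fin n) (ZMod p)}

theorem sum_smul_row_eq_zero {y : Fin m → ZMod p} (hy : Matrix.vecMul y B = 0) {T : Finset (Fin m)}
    (hT : ∀ i, i ∉ T → y i = 0) : ∑ i : {i : Fin m // i ∈ T}, y i.1 • B i.1 = 0 := by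
  rw [Finset.sum_coe_sort T (fun i => y i • B i), ← hy, Matrix.vecMul_eq_sum]
  exact Finset.sum_subset (subset_univ T) fun i _ hi => by rw [hT i hi, zero_smul]

/-- The dual of an MDS code of dimension `n` has minimum distance greater than `n`. -/
theorem IsMDSGenerator.lt_card_support (hB : IsMDSGenerator B) {y : Fin m → ZMod p}
    (hy : Matrix.vecMul y B = 0) (hy0 : y ≠ 0) : n < (univ.filter fun i => y i ≠ 0).card := by
  by_contra! hle
  obtain ⟨T, hsub, hT⟩ := Finset.exists_superset_card_eq hle (by simpa using hB.1)
  have hzero : ∀ i, i ∉ T → y i = 0 := fun i hi => by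
    by_contra h; exact hi (hsub (by simp [h]))
  have h := Fintype.linearIndependent_iff.1 (hB.2 T hT) (fun i => y i.1)
    (sum_smul_row_eq_zero hy hzero)
  refine hy0 (funext fun i => ?_)
  by_cases hi : i ∈ T
  · exact h ⟨i, hi⟩
  · exact hzero i hi

theorem IsMDSGenerator.eq_zero_of_vanish (hB : IsMDSGenerator B) {y : Fin m → ZMod p}
    (hy : Matrix.vecMul y B = 0) {J : Finset (Fin m)} (hJ : J.card ≤ n)
    (h : ∀ i, i ∉ J → y i = 0) : y = 0 := by
  by_contra hy0
  refine absurd (hB.lt_card_support hy hy0) (not_lt.2 (le_trans (Finset.card_le_card ?_) hJ))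
  intro i hi
  by_contra hiJ
  exact (Finset.mem_filter.1 hi).2 (h i hiJ)

theorem exists_dual_word (B : Matrix (Fin m) (Fin n) (ZMod p)) {T : Finset (Fin m)}
    (hT : n < T.card) :
    ∃ y : Fin m → ZMod p, Matrix.vecMul y B = 0 ∧ y ≠ 0 ∧ ∀ i, i ∉ T → y i = 0 := by
  have hdep : ¬ LinearIndependent (ZMod p) (fun i : {i : Fin m // i ∈ T} => B i.1) := by
    intro h
    have := h.fintype_card_le_finrank
    rw [Module.finrank_fin_fun, Fintype.card_coe] at this
    omega
  obtain ⟨g, hg, i, hi⟩ := Fintype.not_linearIndependent_iff.1 hdep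
  refine ⟨fun j => if h : j ∈ T then g ⟨j, h⟩ else 0, ?_, ?_, fun j hj => by simp [hj]⟩
  · rw [Matrix.vecMul_eq_sum, ← hg, ← Finset.sum_subset (subset_univ T) (fun j _ hj => by simp [hj]),
      ← Finset.sum_coe_sort T]
    refine Finset.sum_congr rfl fun j _ => ?_
    simp
  · intro h0
    have := congrFun h0 i.1
    simp at this
    exact hi this

/-- An MDS code of codimension at least two needs a large field: two dual words whose supports have
`n + 1` elements and share `n` of them have pairwise distinct nonzero ratios on the common part. -/
theorem IsMDSGenerator.lt_prime (hB : IsMDSGenerator B) (hm : n + 2 ≤ m) : n < p := by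
  obtain ⟨T, -, hT⟩ := Finset.exists_subset_card_eq (s := (univ : Finset (Fin m))) (n := n)
    (by simp; omega)
  obtain ⟨a, ha⟩ : ∃ a, a ∉ T := by
    by_contra! h
    have := Finset.card_eq_iff_eq_univ T |>.2 (Finset.eq_univ_iff_forall.2 h)
    simp at this; omega
  obtain ⟨b, hb⟩ : ∃ b, b ∉ insert a T := by
    by_contra! h
    have := Finset.card_eq_iff_eq_univ (insert a T) |>.2 (Finset.eq_univ_iff_forall.2 h)
    rw [Finset.card_insert_of_notMem ha] at this
    simp at this; omega
  have hab : b ≠ a ∧ b ∉ T := by simpa using hb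
  -- A dual word supported on `insert c T` vanishes nowhere on it.
  have key : ∀ c, c ∉ T → ∃ y : Fin m → ZMod p, Matrix.vecMul y B = 0 ∧ y c ≠ 0 ∧
      (∀ i ∈ T, y i ≠ 0) ∧ ∀ i, i ∉ insert c T → y i = 0 := by
    intro c hc
    have hcard : (insert c T).card = n + 1 := by rw [Finset.card_insert_of_notMem hc, hT]
    obtain ⟨y, hy, hy0, hyT⟩ := exists_dual_word B (T := insert c T) (by omega)
    have hne : ∀ i ∈ insert c T, y i ≠ 0 := by
      intro i hi h0
      refine hy0 (hB.eq_zero_of_vanish hy (J := (insert c T).erase i) ?_ ?_)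
      · rw [Finset.card_erase_of_mem hi]; omega
      · intro j hj
        by_cases hji : j = i
        · rw [hji, h0]
        · exact hyT j fun h => hj (Finset.mem_erase.2 ⟨hji, h⟩)
    exact ⟨y, hy, hne c (mem_insert_self _ _), fun i hi => hne i (mem_insert_of_mem hi), hyT⟩
  obtain ⟨y, hy, hya, hyT, hy0⟩ := key a ha
  obtain ⟨z, hz, hzb, hzT, hz0⟩ := key b hab.2
  by_contra! hp
  have hlt : (univ.erase (0 : ZMod p)).card < T.card := by
    rw [Finset.card_erase_of_mem (mem_univ _), Finset.card_univ, ZMod.card, hT]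
    have := (Fact.out : p.Prime).pos
    omega
  obtain ⟨i, hi, j, hj, hij, heq⟩ := Finset.exists_ne_map_eq_of_card_lt_of_maps_to hlt
    (f := fun i => y i / z i)
    (fun i hi => Finset.mem_coe.2 (Finset.mem_erase.2
      ⟨div_ne_zero (hyT i hi) (hzT i hi), mem_univ _⟩))
  have hw : Matrix.vecMul (y - (y i / z i) • z) B = 0 := by
    rw [Matrix.sub_vecMul, Matrix.smul_vecMul, hy, hz]; simp
  have h0 := hB.eq_zero_of_vanish hw (J := insert a (insert b ((T.erase i).erase j))) ?_ ?_
  · have := congrFun h0 a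
    have hza : z a = 0 := hz0 a (by simp [hab.1.symm, ha])
    simp [hza, hya] at this
  · refine (Finset.card_insert_le _ _).trans ?_
    have := Finset.card_insert_le b ((T.erase i).erase j)
    rw [Finset.card_erase_of_mem (Finset.mem_erase.2 ⟨hij.symm, hj⟩), Finset.card_erase_of_mem hi,
      hT] at this
    have h2 : 1 < T.card := Finset.one_lt_card.2 ⟨i, hi, j, hj, hij⟩
    omega
  · intro l hl
    have hla : l ≠ a := fun h => hl (by simp [h])
    have hlb : l ≠ b := fun h => hl (by simp [h])
    simp only [Pi.sub_apply, Pi.smul_apply, smul_eq_mul]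
    by_cases hlT : l ∈ T
    · have : l = i ∨ l = j := by
        by_contra! h
        exact hl (by simp [h.1, h.2, hlT])
      rcases this with rfl | rfl
      · rw [div_mul_cancel₀ _ (hzT _ hi), sub_self]
      · have heq' : y i / z i = y l / z l := heq
        rw [heq', div_mul_cancel₀ _ (hzT _ hj), sub_self]
    · rw [hy0 l (by simp [hla, hlT]), hz0 l (by simp [hlb, hlT])]; simp

/-- Any `m - n` coordinates of a dual word determine it. -/
theorem IsMDSGenerator.sum_prod_sq_le (hB : IsMDSGenerator B) {G : Fin m → ZMod p → ℝ}
    (hG2 : ∀ i, ∑ a, G i a ^ 2 ≤ 2) {J : Finset (Fin m)} (hJ : J.card = m - n) :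
    ∑ y ∈ univ.filter (fun y : Fin m → ZMod p => Matrix.vecMul y B = 0), (∏ i ∈ J, G i (y i)) ^ 2
      ≤ 2 ^ (m - n) := by
  have hinj : Set.InjOn (fun (y : Fin m → ZMod p) (i : J) => y i.1)
      (univ.filter (fun y : Fin m → ZMod p => Matrix.vecMul y B = 0) : Finset _) := by
    intro y hy z hz hyz
    have hy' : Matrix.vecMul y B = 0 := by simpa using hy
    have hz' : Matrix.vecMul z B = 0 := by simpa using hz
    have h0 := hB.eq_zero_of_vanish (y := y - z) (J := Jᶜ)
      (by rw [Matrix.sub_vecMul, hy', hz', sub_self])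
      (by rw [Finset.card_compl, hJ, Fintype.card_fin]; omega) (by
        intro i hi
        have : i ∈ J := by simpa using hi
        exact sub_eq_zero.2 (congrFun hyz ⟨i, this⟩))
    exact sub_eq_zero.1 h0
  have h1 : ∀ y : Fin m → ZMod p, (∏ i ∈ J, G i (y i)) ^ 2
      = (fun z : J → ZMod p => ∏ i : J, G i.1 (z i) ^ 2) (fun i : J => y i.1) := by
    intro y
    rw [← Finset.prod_pow]
    exact (Finset.prod_coe_sort J (fun i => G i (y i) ^ 2)).symm
  simp_rw [h1]
  rw [← Finset.sum_image (f := fun z : J → ZMod p => ∏ i : J, G i.1 (z i) ^ 2) hinj]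
  calc _ ≤ ∑ z : J → ZMod p, ∏ i : J, G i.1 (z i) ^ 2 :=
        Finset.sum_le_sum_of_subset_of_nonneg (subset_univ _)
          fun _ _ _ => Finset.prod_nonneg fun _ _ => sq_nonneg _
    _ = ∏ i : J, ∑ a, G i.1 a ^ 2 := by
        rw [Finset.prod_univ_sum, Fintype.piFinset_univ]
    _ ≤ ∏ _i : J, (2 : ℝ) :=
        Finset.prod_le_prod (fun _ _ => Finset.sum_nonneg fun _ _ => sq_nonneg _) fun i _ => hG2 i
    _ = 2 ^ (m - n) := by simp [hJ]

/-- The total weight of the nonzero dual words. Two disjoint sets of `m - n` coordinates are treated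
by the Cauchy–Schwarz inequality and Parseval, and each of the nonzero coordinates outside them,
at least `3 n - 2 m` in number, contributes a factor `g`. -/
theorem IsMDSGenerator.sum_dual_le (hB : IsMDSGenerator B) {G : Fin m → ZMod p → ℝ} {g : ℝ}
    (hG0 : ∀ i a, 0 ≤ G i a) (hG1 : ∀ i, G i 0 ≤ 1) (hGg : ∀ i a, a ≠ 0 → G i a ≤ g)
    (hg0 : 0 ≤ g) (hg1 : g ≤ 1)
    (hG2 : ∀ i, ∑ a, G i a ^ 2 ≤ 2) (hmn : 2 * m ≤ 3 * n) :
    ∑ y ∈ (univ.filter (fun y : Fin m → ZMod p => Matrix.vecMul y B = 0)).erase 0,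
      ∏ i, G i (y i) ≤ 2 ^ (m - n) * g ^ (3 * n - 2 * m) := by
  have hnm := hB.1
  obtain ⟨I, -, hI⟩ := Finset.exists_subset_card_eq (s := (univ : Finset (Fin m))) (n := m - n)
    (by simp)
  obtain ⟨J, hJI, hJ⟩ := Finset.exists_subset_card_eq (s := Iᶜ) (n := m - n)
    (by rw [Finset.card_compl, hI, Fintype.card_fin]; omega)
  set C := univ.filter (fun y : Fin m → ZMod p => Matrix.vecMul y B = 0) with hC
  set K : Finset (Fin m) := Iᶜ \ J with hK
  have hdisj : Disjoint I J := by
    rw [Finset.disjoint_left]; intro i hi hj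
    exact Finset.mem_compl.1 (hJI hj) hi
  have hprod : ∀ y : Fin m → ZMod p, ∏ i, G i (y i)
      = (∏ i ∈ I, G i (y i)) * (∏ i ∈ J, G i (y i)) * ∏ i ∈ K, G i (y i) := by
    intro y
    rw [← Finset.prod_mul_prod_compl I, mul_assoc, ← Finset.prod_sdiff hJI, mul_comm (∏ i ∈ J, _)]
  have hKle : ∀ y ∈ C.erase 0, ∏ i ∈ K, G i (y i) ≤ g ^ (3 * n - 2 * m) := by
    intro y hy
    have hyC : Matrix.vecMul y B = 0 := (Finset.mem_filter.1 (Finset.mem_of_mem_erase hy)).2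
    have hsupp := hB.lt_card_support hyC (Finset.ne_of_mem_erase hy)
    have hcard : 3 * n - 2 * m ≤ (K.filter fun i => y i ≠ 0).card := by
      have hsub : (univ.filter fun i => y i ≠ 0) ⊆ (I ∪ J) ∪ K.filter fun i => y i ≠ 0 := by
        intro i hi
        by_cases h1 : i ∈ I
        · simp [h1]
        by_cases h2 : i ∈ J
        · simp [h2]
        have : y i ≠ 0 := by simpa using hi
        simp [hK, h1, h2, this]
      have h1 := Finset.card_le_card hsub
      have h2 := Finset.card_union_le (I ∪ J) (K.filter fun i => y i ≠ 0)
      have h3 := Finset.card_union_le I J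
      omega
    calc ∏ i ∈ K, G i (y i) ≤ ∏ i ∈ K, (if y i ≠ 0 then g else 1) := by
          refine Finset.prod_le_prod (fun _ _ => hG0 _ _) fun i _ => ?_
          by_cases h : y i = 0
          · simpa [h] using hG1 i
          · simpa [h] using hGg i _ h
      _ = g ^ (K.filter fun i => y i ≠ 0).card := by
          rw [Finset.prod_ite, Finset.prod_const, Finset.prod_const_one, mul_one]
      _ ≤ _ := pow_le_pow_of_le_one hg0 hg1 hcard
  have hpos : ∀ (L : Finset (Fin m)) (y : Fin m → ZMod p), 0 ≤ ∏ i ∈ L, G i (y i) :=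
    fun L y => Finset.prod_nonneg fun i _ => hG0 _ _
  have hCS : ∑ y ∈ C, (∏ i ∈ I, G i (y i)) * (∏ i ∈ J, G i (y i)) ≤ 2 ^ (m - n) := by
    have h := Finset.sum_mul_sq_le_sq_mul_sq C (fun y => ∏ i ∈ I, G i (y i))
      (fun y => ∏ i ∈ J, G i (y i))
    have h1 := hB.sum_prod_sq_le hG2 hI
    have h2 := hB.sum_prod_sq_le hG2 hJ
    refine (sq_le_sq₀ (Finset.sum_nonneg fun y _ => mul_nonneg (hpos _ _) (hpos _ _))
      (by positivity)).1 ?_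
    calc _ ≤ _ := h
      _ ≤ 2 ^ (m - n) * 2 ^ (m - n) :=
          mul_le_mul h1 h2 (Finset.sum_nonneg fun _ _ => sq_nonneg _) (by positivity)
      _ = _ := by ring
  calc ∑ y ∈ C.erase 0, ∏ i, G i (y i)
      ≤ ∑ y ∈ C.erase 0, ((∏ i ∈ I, G i (y i)) * (∏ i ∈ J, G i (y i))) * g ^ (3 * n - 2 * m) := by
        refine Finset.sum_le_sum fun y hy => ?_
        rw [hprod]
        exact mul_le_mul_of_nonneg_left (hKle y hy) (mul_nonneg (hpos _ _) (hpos _ _))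
    _ = (∑ y ∈ C.erase 0, (∏ i ∈ I, G i (y i)) * (∏ i ∈ J, G i (y i))) * g ^ (3 * n - 2 * m) := by
        rw [Finset.sum_mul]
    _ ≤ _ := by
        refine mul_le_mul_of_nonneg_right (le_trans ?_ hCS) (pow_nonneg hg0 _)
        exact Finset.sum_le_sum_of_subset_of_nonneg (Finset.erase_subset _ _)
          fun y _ _ => mul_nonneg (hpos _ _) (hpos _ _)

/-- The average of `∏ i ∈ T, h i` over the code generated by `B`. -/
noncomputable def codeMoment (B : Matrix (Fin m) (Fin n) (ZMod p)) (h : Fin m → ZMod p → ℝ)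
    (T : Finset (Fin m)) : ℝ :=
  ((p : ℝ) ^ n)⁻¹ * ∑ x : Fin n → ZMod p, ∏ i ∈ T, h i (B.mulVec x i)

theorem codeMoment_empty (h : Fin m → ZMod p → ℝ) : codeMoment B h ∅ = 1 := by
  have hp : (p : ℝ) ≠ 0 := by exact_mod_cast (Fact.out : p.Prime).ne_zero
  simp [codeMoment, ZMod.card, hp]

theorem fourierHat_one (a : ZMod p) : fourierHat (fun _ => 1) a = if a = 0 then 1 else 0 := by
  have hp : (p : ℂ) ≠ 0 := by exact_mod_cast (Fact.out : p.Prime).ne_zero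
  have := sum_stdAddChar_mul (-a)
  rw [fourierHat]
  simp only [neg_mul, neg_eq_zero] at this
  simp only [Complex.ofReal_one, one_mul, this]
  split_ifs <;> simp [hp]

theorem fourierHat_zero_of_sum_eq_zero {f : ZMod p → ℝ} (hf : ∑ t, f t = 0) :
    fourierHat f 0 = 0 := by
  have : ((∑ t, f t : ℝ) : ℂ) = 0 := by rw [hf]; simp
  push_cast at this
  simp [fourierHat, this]

theorem codeMoment_eq (h : Fin m → ZMod p → ℝ) (T : Finset (Fin m)) :
    (codeMoment B h T : ℂ)
      = ∑ y ∈ univ.filter (fun y : Fin m → ZMod p => Matrix.vecMul y B = 0),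
          ∏ i, if i ∈ T then fourierHat (h i) (y i) else if y i = 0 then 1 else 0 := by
  have hp : (p : ℂ) ≠ 0 := by exact_mod_cast (Fact.out : p.Prime).ne_zero
  have h1 : codeMoment B h T = ((p : ℝ) ^ n)⁻¹ * ∑ x : Fin n → ZMod p,
      ∏ i, (if i ∈ T then h i else fun _ => 1) (B.mulVec x i) := by
    rw [codeMoment]
    congr 1
    refine Finset.sum_congr rfl fun x _ => ?_
    rw [← Finset.univ_inter T, ← Finset.prod_ite_mem]
    refine Finset.prod_congr rfl fun i _ => ?_
    by_cases hi : i ∈ T <;> simp [hi]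
  rw [h1, Complex.ofReal_mul, sum_prod_mulVec B (fun i => if i ∈ T then h i else fun _ => 1)]
  push_cast
  rw [inv_mul_cancel_left₀ (pow_ne_zero _ hp)]
  refine Finset.sum_congr rfl fun y _ => Finset.prod_congr rfl fun i _ => ?_
  by_cases hi : i ∈ T
  · simp [hi]
  · simp [hi, fourierHat_one]

theorem IsMDSGenerator.codeMoment_eq_zero (hB : IsMDSGenerator B) {h : Fin m → ZMod p → ℝ}
    (h0 : ∀ i, ∑ t, h i t = 0) {T : Finset (Fin m)} (hT : T.Nonempty) (hTn : T.card ≤ n) :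
    codeMoment B h T = 0 := by
  have : (codeMoment B h T : ℂ) = 0 := by
    rw [codeMoment_eq]
    refine Finset.sum_eq_zero fun y hy => ?_
    have hyC : Matrix.vecMul y B = 0 := (Finset.mem_filter.1 hy).2
    by_cases hy0 : y = 0
    · obtain ⟨i, hi⟩ := hT
      exact Finset.prod_eq_zero (mem_univ i)
        (by simp [hi, hy0, fourierHat_zero_of_sum_eq_zero (h0 i)])
    · obtain ⟨i, hi, hiT⟩ := Finset.exists_mem_notMem_of_card_lt_card
        (hTn.trans_lt (hB.lt_card_support hyC hy0))
      have : y i ≠ 0 := by simpa using hi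
      exact Finset.prod_eq_zero (mem_univ i) (by simp [hiT, this])
  exact_mod_cast this

theorem sum_abs_codeMoment_le {h : Fin m → ZMod p → ℝ} (h0 : ∀ i, ∑ t, h i t = 0) :
    ∑ T ∈ univ.erase (∅ : Finset (Fin m)), |codeMoment B h T|
      ≤ ∑ y ∈ (univ.filter (fun y : Fin m → ZMod p => Matrix.vecMul y B = 0)).erase 0,
          ∏ i, (‖fourierHat (h i) (y i)‖ + if y i = 0 then 1 else 0) := by
  set C := univ.filter (fun y : Fin m → ZMod p => Matrix.vecMul y B = 0) with hC
  have h1 : ∀ T ∈ univ.erase (∅ : Finset (Fin m)), |codeMoment B h T|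
      ≤ ∑ y ∈ C.erase 0, (∏ i ∈ T, ‖fourierHat (h i) (y i)‖)
          * ∏ i ∈ univ \ T, (if y i = 0 then (1 : ℝ) else 0) := by
    intro T hT
    obtain ⟨j, hj⟩ := Finset.nonempty_iff_ne_empty.2 (Finset.ne_of_mem_erase hT)
    have h2 : |codeMoment B h T| = ‖(codeMoment B h T : ℂ)‖ := by simp
    have h0C : (0 : Fin m → ZMod p) ∈ C := by simp [hC]
    rw [h2, codeMoment_eq, ← hC, ← Finset.add_sum_erase _ _ h0C,
      Finset.prod_eq_zero (mem_univ j)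
        (by simp [hj, fourierHat_zero_of_sum_eq_zero (h0 j)]), zero_add]
    refine (norm_sum_le _ _).trans (le_of_eq (Finset.sum_congr rfl fun y _ => ?_))
    rw [norm_prod, ← Finset.prod_mul_prod_compl T, Finset.compl_eq_univ_sdiff]
    congr 1
    · exact Finset.prod_congr rfl fun i hi => by simp [hi]
    · refine Finset.prod_congr rfl fun i hi => ?_
      have : i ∉ T := (Finset.mem_sdiff.1 hi).2
      by_cases hy : y i = 0 <;> simp [this, hy]
  refine (Finset.sum_le_sum h1).trans ?_
  rw [Finset.sum_comm]
  refine Finset.sum_le_sum fun y _ => ?_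
  rw [Finset.prod_add, Finset.powerset_univ]
  refine Finset.sum_le_sum_of_subset_of_nonneg (Finset.erase_subset _ _) fun T _ _ => ?_
  exact mul_nonneg (Finset.prod_nonneg fun _ _ => norm_nonneg _)
    (Finset.prod_nonneg fun _ _ => by split_ifs <;> norm_num)

/-- The total mass of the nonconstant moments of balanced functions over an MDS code. -/
theorem IsMDSGenerator.sum_abs_codeMoment_le (hB : IsMDSGenerator B) {h : Fin m → ZMod p → ℝ}
    (h0 : ∀ i, ∑ t, h i t = 0) (h1 : ∀ i t, |h i t| ≤ 1) {g : ℝ} (hg0 : 0 ≤ g) (hg1 : g ≤ 1)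
    (hg : n + 2 ≤ m → ∀ i a, a ≠ 0 → ‖fourierHat (h i) a‖ ≤ g) (hm : m ≠ n + 1)
    (hmn : 2 * m ≤ 3 * n) :
    ∑ T ∈ univ.erase (∅ : Finset (Fin m)), |codeMoment B h T|
      ≤ 2 ^ (m - n) * g ^ (3 * n - 2 * m) := by
  refine (_root_.sum_abs_codeMoment_le h0).trans ?_
  by_cases hnm : n + 2 ≤ m
  · refine hB.sum_dual_le (G := fun i a => ‖fourierHat (h i) a‖ + if a = 0 then 1 else 0)
      ?_ ?_ ?_ hg0 hg1 ?_ hmn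
    · intro i a; positivity
    · intro i; simp [fourierHat_zero_of_sum_eq_zero (h0 i)]
    · intro i a ha; simpa [ha] using hg hnm i a ha
    · intro i
      have hsq : ∀ a, (‖fourierHat (h i) a‖ + if a = 0 then 1 else 0) ^ 2
          = ‖fourierHat (h i) a‖ ^ 2 + if a = 0 then 1 else 0 := by
        intro a
        by_cases ha : a = 0
        · simp [ha, fourierHat_zero_of_sum_eq_zero (h0 i)]
        · simp [ha]
      have hp : (0 : ℝ) < p := by exact_mod_cast (Fact.out : p.Prime).pos
      have hle : (p : ℝ)⁻¹ * ∑ t, h i t ^ 2 ≤ 1 := by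
        rw [inv_mul_le_iff₀ hp, mul_one]
        calc ∑ t, h i t ^ 2 ≤ ∑ _t : ZMod p, (1 : ℝ) :=
              Finset.sum_le_sum fun t _ => (sq_le_one_iff_abs_le_one _).2 (h1 i t)
          _ = p := by simp [ZMod.card]
      simp_rw [hsq]
      rw [Finset.sum_add_distrib, fourierHat_parseval, Finset.sum_ite_eq' univ (0 : ZMod p)]
      simp only [mem_univ, if_true]
      linarith
  · -- Here `n = m`, and the zero word is the only dual word.
    have hempty : (univ.filter (fun y : Fin m → ZMod p => Matrix.vecMul y B = 0)).erase 0 = ∅ := by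
      rw [Finset.eq_empty_iff_forall_notMem]
      intro y hy
      have := hB.lt_card_support (Finset.mem_filter.1 (Finset.mem_of_mem_erase hy)).2
        (Finset.ne_of_mem_erase hy)
      have h2 := Finset.card_le_univ (univ.filter fun i => y i ≠ 0)
      rw [Fintype.card_fin] at h2
      have := hB.1
      omega
    rw [hempty, Finset.sum_empty]
    positivity

end MDS

/-! ### Independent spins with given means -/

section SpinWeight

open Finset

/-- The probability of the spin vector `σ` when its entries are independent with means `v i`. -/
noncomputable def spinWeight {ι : Type*} [Fintype ι] (v : ι → ℝ) (σ : ι → Bool) : ℝ :=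
  ∏ i, (1 + (if σ i then (1 : ℝ) else -1) * v i) / 2

theorem spinWeight_nonneg {ι : Type*} [Fintype ι] {v : ι → ℝ} (hv : ∀ i, |v i| ≤ 1)
    (σ : ι → Bool) : 0 ≤ spinWeight v σ := by
  refine Finset.prod_nonneg fun i _ => ?_
  have := abs_le.1 (hv i)
  cases σ i
  · simp; linarith [this.2]
  · simp; linarith [this.1]

theorem sum_sign_eq {ι : Type*} [Fintype ι] (σ : ι → Bool) :
    ∑ i, (if σ i then (1 : ℝ) else -1)
      = 2 * (univ.filter fun i => σ i = true).card - Fintype.card ι := by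
  rw [Finset.sum_ite]
  have h := Finset.card_filter_add_card_filter_not (s := (univ : Finset ι)) (fun i => σ i = true)
  rw [Finset.card_univ] at h
  have h' : ((univ.filter fun i => σ i = true).card : ℝ)
      + (univ.filter fun i => ¬ σ i = true).card = Fintype.card ι := by exact_mod_cast h
  simp only [Finset.sum_const, nsmul_eq_mul]
  linarith

variable {ι : Type*} [Fintype ι] [DecidableEq ι]

/-- Large deviations for the number of positive spins outside `R`, where a positive spin has
probability at most `τ`. -/
theorem sum_spinWeight_tail_le {v : ι → ℝ} (hv : ∀ i, |v i| ≤ 1) {R : Finset ι} {τ : ℝ}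
    (hτ0 : 0 < τ) (hτ1 : τ ≤ 1) (hR : ∀ i, i ∉ R → (1 + v i) / 2 ≤ τ) (s : ℕ) :
    ∑ σ, spinWeight v σ *
        (if s < (univ.filter fun i => σ i = true ∧ i ∉ R).card then (1 : ℝ) else 0)
      ≤ 2 ^ Fintype.card ι * τ ^ s := by
  have h1 : ∀ σ : ι → Bool, spinWeight v σ *
        (if s < (univ.filter fun i => σ i = true ∧ i ∉ R).card then (1 : ℝ) else 0)
      ≤ (∏ i, ((1 + (if σ i then (1 : ℝ) else -1) * v i) / 2
          * if σ i = true ∧ i ∉ R then τ⁻¹ else 1)) * τ ^ s := by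
    intro σ
    rw [Finset.prod_mul_distrib, ← spinWeight, mul_assoc]
    refine mul_le_mul_of_nonneg_left ?_ (spinWeight_nonneg hv σ)
    rw [Finset.prod_ite, Finset.prod_const, Finset.prod_const_one, mul_one]
    split_ifs with h
    · rw [inv_pow, inv_mul_eq_div, le_div_iff₀ (pow_pos hτ0 _), one_mul]
      exact pow_le_pow_of_le_one hτ0.le hτ1 h.le
    · positivity
  refine (Finset.sum_le_sum fun σ _ => h1 σ).trans ?_
  rw [← Finset.sum_mul]
  refine mul_le_mul_of_nonneg_right ?_ (by positivity)
  have h2 := Finset.prod_univ_sum (fun _ : ι => (univ : Finset Bool))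
    (fun i b => ((1 + (if b then (1 : ℝ) else -1) * v i) / 2
      * if b = true ∧ i ∉ R then τ⁻¹ else 1))
  rw [Fintype.piFinset_univ] at h2
  rw [← h2]
  calc _ ≤ ∏ _i : ι, (2 : ℝ) := by
        refine Finset.prod_le_prod ?_ ?_
        · intro i _
          refine Finset.sum_nonneg fun b _ => mul_nonneg ?_ (by split_ifs <;> positivity)
          have := abs_le.1 (hv i)
          cases b
          · simp; linarith [this.2]
          · simp; linarith [this.1]
        · intro i _
          have := abs_le.1 (hv i)
          by_cases hi : i ∈ R
          · simp [hi]; linarith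
          · have h3 : (1 + v i) / 2 * τ⁻¹ ≤ 1 := by
              rw [← div_eq_mul_inv, div_le_one hτ0]; exact hR i hi
            simp [hi]; linarith
    _ = 2 ^ Fintype.card ι := by simp

/-- If `R` has at most `N` elements, then integrating the total spin against a nonnegative `f` gives
at most `r` times the integral of `f`, up to the rare event of many positive spins outside `R`. -/
theorem sum_spinWeight_mul_sign_le {v : ι → ℝ} (hv : ∀ i, |v i| ≤ 1) {R : Finset ι} {τ : ℝ}
    (hτ0 : 0 < τ) (hτ1 : τ ≤ 1) (hR : ∀ i, i ∉ R → (1 + v i) / 2 ≤ τ) (s : ℕ) {r e K : ℝ}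
    (hr : 2 * (R.card : ℝ) + 2 * s - Fintype.card ι ≤ r) (he0 : 0 ≤ e)
    (he : (Fintype.card ι : ℝ) ≤ r + e) {f : (ι → Bool) → ℝ}
    (hf0 : ∀ σ, 0 ≤ f σ) (hfK : ∀ σ, f σ ≤ K) :
    ∑ σ, spinWeight v σ * (f σ * ∑ i, (if σ i then (1 : ℝ) else -1))
      ≤ r * ∑ σ, spinWeight v σ * f σ + e * K * (2 ^ Fintype.card ι * τ ^ s) := by
  have hpt : ∀ σ : ι → Bool, spinWeight v σ * (f σ * ∑ i, (if σ i then (1 : ℝ) else -1))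
      ≤ r * (spinWeight v σ * f σ) + e * K * (spinWeight v σ *
        (if s < (univ.filter fun i => σ i = true ∧ i ∉ R).card then (1 : ℝ) else 0)) := by
    intro σ
    have hw := spinWeight_nonneg hv σ
    have hwf := mul_nonneg hw (hf0 σ)
    by_cases hs : s < (univ.filter fun i => σ i = true ∧ i ∉ R).card
    · have hZ : ∑ i, (if σ i then (1 : ℝ) else -1) ≤ r + e := by
        rw [sum_sign_eq]
        have : ((univ.filter fun i => σ i = true).card : ℝ) ≤ Fintype.card ι := by
          exact_mod_cast Finset.card_le_univ _
        linarith
      have h1 : f σ * ∑ i, (if σ i then (1 : ℝ) else -1) ≤ r * f σ + e * K := by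
        have := mul_le_mul_of_nonneg_left hZ (hf0 σ)
        have := mul_le_mul_of_nonneg_left (hfK σ) he0
        linarith
      have := mul_le_mul_of_nonneg_left h1 hw
      simp only [hs, if_true]
      linarith
    · have hZ : ∑ i, (if σ i then (1 : ℝ) else -1) ≤ r := by
        rw [sum_sign_eq]
        have hsub : (univ.filter fun i => σ i = true)
            ⊆ R ∪ univ.filter fun i => σ i = true ∧ i ∉ R := by
          intro i hi
          by_cases h : i ∈ R
          · simp [h]
          · have : σ i = true := by simpa using hi
            simp [h, this]
        have h2 := (Finset.card_le_card hsub).trans (Finset.card_union_le _ _)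
        have h3 : (univ.filter fun i => σ i = true).card ≤ R.card + s := by omega
        have : ((univ.filter fun i => σ i = true).card : ℝ) ≤ R.card + s := by exact_mod_cast h3
        linarith
      have := mul_le_mul_of_nonneg_left hZ hwf
      simp only [hs, if_false]
      linarith
  refine (Finset.sum_le_sum fun σ _ => hpt σ).trans ?_
  rw [Finset.sum_add_distrib, ← Finset.mul_sum, ← Finset.mul_sum]
  refine add_le_add le_rfl (mul_le_mul_of_nonneg_left
    (sum_spinWeight_tail_le hv hτ0 hτ1 hR s) (mul_nonneg he0 ?_))
  exact (hf0 fun _ => true).trans (hfK _)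

end SpinWeight

/-! ### Balanced signs for a list -/

section BalancedSign

open Finset

variable {p : ℕ} [Fact p.Prime]

/-- The conditional mean of the spin attached to a list `S ⊆ 𝔽_p` of density `ρ`: the multiple of
`1_S - ρ` that is as large as a function with values in `[-1, 1]` can be. It has mean zero exactly,
and for `ρ` near `1/2` it is near `1` on `S` and near `-1` off `S`. -/
noncomputable def balancedSign (S : Finset (ZMod p)) (t : ZMod p) : ℝ :=
  ((if t ∈ S then 1 else 0) - (S.card : ℝ) / p) / max ((S.card : ℝ) / p) (1 - (S.card : ℝ) / p)

theorem half_le_max_density (ρ : ℝ) : 1 / 2 ≤ max ρ (1 - ρ) := by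
  rcases le_total ρ (1 / 2) with h | h
  · exact le_max_of_le_right (by linarith)
  · exact le_max_of_le_left h

theorem density_mem (S : Finset (ZMod p)) : 0 ≤ (S.card : ℝ) / p ∧ (S.card : ℝ) / p ≤ 1 := by
  have hp : (0 : ℝ) < p := by exact_mod_cast (Fact.out : p.Prime).pos
  refine ⟨by positivity, (div_le_one hp).2 ?_⟩
  have := Finset.card_le_univ S
  rw [ZMod.card] at this
  exact_mod_cast this

theorem sum_balancedSign (S : Finset (ZMod p)) : ∑ t, balancedSign S t = 0 := by
  have hp : (p : ℝ) ≠ 0 := by exact_mod_cast (Fact.out : p.Prime).ne_zero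
  simp only [balancedSign]
  rw [← Finset.sum_div, Finset.sum_sub_distrib]
  simp [ZMod.card, mul_div_cancel₀ _ hp, Finset.sum_ite_mem]

theorem abs_balancedSign_le (S : Finset (ZMod p)) (t : ZMod p) : |balancedSign S t| ≤ 1 := by
  obtain ⟨h0, h1⟩ := density_mem S
  have hmax := half_le_max_density ((S.card : ℝ) / p)
  rw [balancedSign, abs_div, abs_of_pos (by linarith : 0 < max ((S.card : ℝ) / p) _),
    div_le_one (by linarith)]
  split_ifs
  · rw [abs_of_nonneg (by linarith)]; exact le_max_right _ _
  · rw [zero_sub, abs_neg, abs_of_nonneg h0]; exact le_max_left _ _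

theorem balancedSign_off_le {S : Finset (ZMod p)} {η : ℝ} (hη : |(S.card : ℝ) / p - 1 / 2| ≤ η)
    {t : ZMod p} (ht : t ∉ S) : (1 + balancedSign S t) / 2 ≤ 2 * η := by
  obtain ⟨h0, h1⟩ := density_mem S
  have hη' := abs_le.1 hη
  have hη0 : 0 ≤ η := (abs_nonneg _).trans hη
  simp only [balancedSign, ht, if_false, zero_sub]
  rcases le_total (1 / 2) ((S.card : ℝ) / p) with h | h
  · rw [max_eq_left (by linarith), neg_div, div_self (by linarith)]
    linarith
  · rw [max_eq_right (by linarith)]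
    have hpos : 0 < 1 - (S.card : ℝ) / p := by linarith
    have : -((S.card : ℝ) / p) / (1 - (S.card : ℝ) / p) ≤ 4 * η - 1 := by
      rw [div_le_iff₀ hpos]
      nlinarith
    linarith

theorem norm_fourierHat_balancedSign_le (S : Finset (ZMod p)) {a : ZMod p} (ha : a ≠ 0) :
    ‖fourierHat (balancedSign S) a‖ ≤ 2 / Real.pi + 4 * Real.pi / p := by
  have hp : (0 : ℝ) < p := by exact_mod_cast (Fact.out : p.Prime).pos
  set ρ : ℝ := (S.card : ℝ) / p with hρ
  set q : ℝ := max ρ (1 - ρ) with hq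
  have hq2 : 1 / 2 ≤ q := half_le_max_density ρ
  have h0 : ∑ t : ZMod p, (ZMod.stdAddChar (-(a * t)) : ℂ) = 0 := by
    have := sum_stdAddChar_mul (-a)
    simpa [ha] using this
  have h1 : fourierHat (balancedSign S) a
      = (p : ℂ)⁻¹ * ((q : ℂ)⁻¹ * ∑ t ∈ S, (ZMod.stdAddChar (-(a * t)) : ℂ)) := by
    rw [fourierHat]
    congr 1
    have h2 : ∀ t : ZMod p, (balancedSign S t : ℂ) * ZMod.stdAddChar (-(a * t))
        = (q : ℂ)⁻¹ * ((if t ∈ S then (ZMod.stdAddChar (-(a * t)) : ℂ) else 0)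
          - ρ * ZMod.stdAddChar (-(a * t))) := by
      intro t
      rw [balancedSign, ← hρ, ← hq]
      by_cases ht : t ∈ S
      · simp [ht]; ring
      · simp [ht]; ring
    simp_rw [h2]
    rw [← Finset.mul_sum, Finset.sum_sub_distrib, ← Finset.mul_sum, h0, Finset.sum_ite_mem]
    simp
  rw [h1, norm_mul, norm_mul, norm_inv, norm_inv, Complex.norm_natCast, Complex.norm_real,
    Real.norm_of_nonneg (by linarith : 0 ≤ q)]
  have h3 : q⁻¹ ≤ 2 := by rw [inv_le_comm₀ (by linarith) (by norm_num)]; linarith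
  calc (p : ℝ)⁻¹ * (q⁻¹ * ‖∑ t ∈ S, (ZMod.stdAddChar (-(a * t)) : ℂ)‖)
      ≤ (p : ℝ)⁻¹ * (2 * (p / Real.pi + 2 * Real.pi)) := by
        have := norm_sum_stdAddChar_mul_le S ha
        gcongr
    _ = _ := by have := Real.pi_pos; field_simp; ring

end BalancedSign

/-! ### The moment inequality -/

section FiniteInequality

open Finset

variable {m n p : ℕ} [Fact p.Prime] {B : Matrix (Fin m) (Fin n) (ZMod p)}

/-- The law of the spin vector obtained from a uniformly random codeword. -/
noncomputable def codeSpin (B : Matrix (Fin m) (Fin n) (ZMod p)) (h : Fin m → ZMod p → ℝ)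
    (σ : Fin m → Bool) : ℝ :=
  ((p : ℝ) ^ n)⁻¹ * ∑ x : Fin n → ZMod p, spinWeight (fun i => h i (B.mulVec x i)) σ

theorem sum_codeSpin_mul_walsh (h : Fin m → ZMod p → ℝ) (T : Finset (Fin m)) :
    ∑ σ, codeSpin B h σ * walsh σ T = codeMoment B h T := by
  simp_rw [codeSpin, codeMoment, mul_assoc, ← Finset.mul_sum, Finset.sum_mul]
  rw [Finset.sum_comm]
  congr 1
  exact Finset.sum_congr rfl fun x _ => sum_prod_mul_walsh _ T

theorem sum_codeSpin_mul (h : Fin m → ZMod p → ℝ) (f : (Fin m → Bool) → ℝ) :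
    ∑ σ, codeSpin B h σ * f σ = ((p : ℝ) ^ n)⁻¹ *
      ∑ x : Fin n → ZMod p, ∑ σ, spinWeight (fun i => h i (B.mulVec x i)) σ * f σ := by
  simp_rw [codeSpin, mul_assoc, ← Finset.mul_sum, Finset.sum_mul]
  rw [Finset.sum_comm]

/-- The quantitative core: if no codeword satisfies more than `N` of the constraints, then the
quadratic form of the total spin at the symmetric polynomial with layers `a` is small. -/
theorem IsMDSGenerator.moment_inequality (hB : IsMDSGenerator B) (S : Fin m → Finset (ZMod p))
    {η : ℝ} (hη0 : 0 < η) (hη1 : 2 * η ≤ 1) (hS : ∀ i, |((S i).card : ℝ) / p - 1 / 2| ≤ η)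
    {g : ℝ} (hg0 : 0 ≤ g) (hg1 : g ≤ 1) (hg : n + 2 ≤ m → 2 / Real.pi + 4 * Real.pi / p ≤ g)
    (hm : m ≠ n + 1) (hmn : 2 * m ≤ 3 * n)
    {N : ℝ} (hN : ∀ x : Fin n → ZMod p,
      ((univ.filter fun i : Fin m => B.mulVec x i ∈ S i).card : ℝ) ≤ N)
    (s : ℕ) {r e : ℝ} (hr : 2 * N + 2 * s - m ≤ r) (he0 : 0 ≤ e) (he : (m : ℝ) ≤ r + e)
    {a : ℕ → ℝ} (ha0 : ∀ j, 0 ≤ a j) {k y : ℝ} (hy : 0 < y) (ha : ∀ j, a j ≤ k * y ^ j) :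
    ∑ i, sqCoeff a ({i} : Finset (Fin m))
      ≤ r * sqCoeff a (∅ : Finset (Fin m))
        + (m + |r|) * ((k ^ 2 * ((1 + y ^ 2) ^ m * (2 * y / (1 + y ^ 2)) ^ n))
            * (2 ^ (m - n) * g ^ (3 * n - 2 * m)))
        + e * (2 ^ m * sqCoeff a (∅ : Finset (Fin m))) * (2 ^ m * (2 * η) ^ s) := by
  set h : Fin m → ZMod p → ℝ := fun i => balancedSign (S i) with hh
  set M : ℝ := k ^ 2 * ((1 + y ^ 2) ^ m * (2 * y / (1 + y ^ 2)) ^ n) with hM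
  set C : ℝ := 2 ^ (m - n) * g ^ (3 * n - 2 * m) with hC
  have hM0 : 0 ≤ M := by positivity
  have hC0 : 0 ≤ C := by positivity
  have hsum0 : ∀ i, ∑ t, h i t = 0 := fun i => sum_balancedSign (S i)
  have habs : ∀ i t, |h i t| ≤ 1 := fun i t => abs_balancedSign_le (S i) t
  have hCb : ∑ T ∈ univ.erase (∅ : Finset (Fin m)), |codeMoment B h T| ≤ C :=
    hB.sum_abs_codeMoment_le hsum0 habs hg0 hg1
      (fun hnm i a ha => (norm_fourierHat_balancedSign_le (S i) ha).trans (hg hnm)) hm hmn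
  have hratio0 : 0 ≤ 2 * y / (1 + y ^ 2) := by positivity
  have hratio1 : 2 * y / (1 + y ^ 2) ≤ 1 := by
    rw [div_le_one (by positivity)]; nlinarith [sq_nonneg (1 - y)]
  have hq : ∀ T : Finset (Fin m), n ≤ T.card → sqCoeff a T ≤ M := by
    intro T hT
    refine (sqCoeff_le hy ha0 ha T).trans ?_
    rw [Fintype.card_fin]
    exact mul_le_mul_of_nonneg_left (mul_le_mul_of_nonneg_left
      (pow_le_pow_of_le_one hratio0 hratio1 hT) (by positivity)) (sq_nonneg _)
  have hE0 := abs_sum_moment_sub_le (fun T => sum_codeSpin_mul_walsh (B := B) h T)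
    (codeMoment_empty h) (fun T hT hTn => hB.codeMoment_eq_zero hsum0 hT hTn) hCb
    (fun σ => symPoly a σ ^ 2) (fun T => sqCoeff a T) (fun σ => symPoly_sq a σ) hM0
    (fun T hT => by rw [abs_of_nonneg (sqCoeff_nonneg ha0 T)]; exact hq T hT.le)
  have hE1 := abs_sum_moment_sub_le (fun T => sum_codeSpin_mul_walsh (B := B) h T)
    (codeMoment_empty h) (fun T hT hTn => hB.codeMoment_eq_zero hsum0 hT hTn) hCb
    (fun σ => symPoly a σ ^ 2 * ∑ i, (if σ i then (1 : ℝ) else -1))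
    (fun T => ∑ i, sqCoeff a (symmDiff T {i})) (fun σ => symPoly_sq_mul_sum a σ)
    (M := m * M) (by positivity) (by
      intro T hT
      rw [abs_of_nonneg (Finset.sum_nonneg fun i _ => sqCoeff_nonneg ha0 _)]
      calc ∑ i, sqCoeff a (symmDiff T {i}) ≤ ∑ _i : Fin m, M := by
            refine Finset.sum_le_sum fun i _ => hq _ ?_
            have hsub : T.erase i ⊆ symmDiff T {i} := by
              intro j hj
              simp [Finset.mem_symmDiff, Finset.ne_of_mem_erase hj, Finset.mem_of_mem_erase hj]
            have := Finset.card_le_card hsub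
            have := Finset.pred_card_le_card_erase (s := T) (a := i)
            omega
        _ = m * M := by simp)
  have hmain : ∑ σ, codeSpin B h σ * (symPoly a σ ^ 2 * ∑ i, (if σ i then (1 : ℝ) else -1))
      ≤ r * ∑ σ, codeSpin B h σ * symPoly a σ ^ 2
        + e * (2 ^ m * sqCoeff a (∅ : Finset (Fin m))) * (2 ^ m * (2 * η) ^ s) := by
    have hp : (0 : ℝ) < (p : ℝ) ^ n := by
      have : (0 : ℝ) < p := by exact_mod_cast (Fact.out : p.Prime).pos
      positivity
    rw [sum_codeSpin_mul, sum_codeSpin_mul]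
    have hx : ∀ x : Fin n → ZMod p, ∑ σ, spinWeight (fun i => h i (B.mulVec x i)) σ
          * (symPoly a σ ^ 2 * ∑ i, (if σ i then (1 : ℝ) else -1))
        ≤ r * ∑ σ, spinWeight (fun i => h i (B.mulVec x i)) σ * symPoly a σ ^ 2
          + e * (2 ^ m * sqCoeff a (∅ : Finset (Fin m))) * (2 ^ m * (2 * η) ^ s) := by
      intro x
      have := sum_spinWeight_mul_sign_le (v := fun i => h i (B.mulVec x i))
        (fun i => habs i _) (R := univ.filter fun i : Fin m => B.mulVec x i ∈ S i)
        (τ := 2 * η) (by linarith) hη1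
        (fun i hi => balancedSign_off_le (hS i) (by simpa using hi)) s (r := r) (e := e)
        (K := 2 ^ m * sqCoeff a (∅ : Finset (Fin m)))
        (by rw [Fintype.card_fin]; linarith [hN x]) he0 (by rw [Fintype.card_fin]; exact he)
        (f := fun σ => symPoly a σ ^ 2) (fun σ => sq_nonneg _)
        (fun σ => by simpa using symPoly_sq_le a σ)
      rwa [Fintype.card_fin] at this
    have hsum := Finset.sum_le_sum fun x (_ : x ∈ (univ : Finset (Fin n → ZMod p))) => hx x
    rw [Finset.sum_add_distrib, ← Finset.mul_sum, Finset.sum_const, nsmul_eq_mul,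
      Finset.card_univ, Fintype.card_fun, ZMod.card, Fintype.card_fin] at hsum
    push_cast at hsum
    have := mul_le_mul_of_nonneg_left hsum (inv_nonneg.2 hp.le)
    rw [mul_add, inv_mul_cancel_left₀ hp.ne'] at this
    linarith
  have hfin : ∑ i, sqCoeff a (symmDiff (∅ : Finset (Fin m)) {i})
      = ∑ i, sqCoeff a ({i} : Finset (Fin m)) := by
    refine Finset.sum_congr rfl fun i _ => ?_
    rw [← Finset.bot_eq_empty, bot_symmDiff]
  simp only [hfin] at hE1
  have h1 := (abs_le.1 hE1).1
  have h2 : r * ∑ σ, codeSpin B h σ * symPoly a σ ^ 2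
      ≤ r * sqCoeff a (∅ : Finset (Fin m)) + |r| * (M * C) := by
    have h3 := mul_le_mul_of_nonneg_left hE0 (abs_nonneg r)
    rw [← abs_mul] at h3
    have := (le_abs_self _).trans h3
    linarith
  linarith

end FiniteInequality

/-! ### Entropy and the exponents -/

section Entropy

open Real

theorem add_mul_binEntropy_div {s t : ℝ} (hs : 0 ≤ s) (ht : 0 ≤ t) :
    (s + t) * binEntropy (s / (s + t)) = negMulLog s + negMulLog t - negMulLog (s + t) := by
  rcases eq_or_lt_of_le (add_nonneg hs ht) with h | h
  · have h1 : s = 0 := by linarith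
    have h2 : t = 0 := by linarith
    simp [h1, h2]
  · have hc : 1 - s / (s + t) = t / (s + t) := by field_simp; ring
    have key : ∀ u, (s + t) * negMulLog (u / (s + t))
        = negMulLog u - u / (s + t) * negMulLog (s + t) := by
      intro u
      have h1 := negMulLog_mul (u / (s + t)) (s + t)
      rw [div_mul_cancel₀ _ h.ne'] at h1
      linarith
    rw [binEntropy_eq_negMulLog_add_negMulLog_one_sub, hc, mul_add, key, key]
    field_simp
    ring

/-- Rewriting `expE` through the multinomial entropy of `(μ, δ, μ, 1 - 2 μ - δ)`: it equals
`2 μ log 2 + (1 - 2 μ) H(δ / (1 - 2 μ)) - H(μ + δ)`. -/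
theorem expE_eq {μ δ : ℝ} (hμ : 0 ≤ μ) (hδ0 : 0 ≤ δ) (hδ1 : δ ≤ 1 / 2 - μ) :
    expE μ δ = negMulLog δ + negMulLog (1 - 2 * μ - δ) - negMulLog (1 - 2 * μ)
      + 2 * μ * log 2 - binEntropy (μ + δ) := by
  have h1 := add_mul_binEntropy_div hμ hδ0
  have h2 := add_mul_binEntropy_div hμ (t := 1 - 2 * μ - δ) (by linarith)
  have e : μ + (1 - 2 * μ - δ) = 1 - μ - δ := by ring
  rw [e] at h2
  have h3 : negMulLog (2 * μ) = 2 * negMulLog μ - 2 * μ * log 2 := by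
    rw [negMulLog_mul]; simp only [negMulLog]; ring
  have e2 : 1 - (μ + δ) = 1 - μ - δ := by ring
  rw [expE, h1, h2, binEntropy_eq_negMulLog_add_negMulLog_one_sub,
    binEntropy_eq_negMulLog_add_negMulLog_one_sub, h3, e2]
  ring

theorem log_two_div_pi_neg : log (2 / π) < 0 :=
  log_neg (by positivity) (by rw [div_lt_one pi_pos]; linarith [pi_gt_three])

/-- A negative exponent forces rate above `2/3`. -/
theorem two_lt_of_exponent_neg {μ δ : ℝ} (hμ : 0 ≤ μ) (hδ0 : 0 ≤ δ) (hδ1 : δ ≤ 1 / 2 - μ)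
    (h : expE μ δ + expF μ < 0) : 2 < 6 * μ := by
  by_contra! hle
  have h1 : 0 ≤ negMulLog δ + negMulLog (1 - 2 * μ - δ) - negMulLog (1 - 2 * μ) := by
    have h2 := add_mul_binEntropy_div hδ0 (t := 1 - 2 * μ - δ) (by linarith)
    have e : δ + (1 - 2 * μ - δ) = 1 - 2 * μ := by ring
    rw [e] at h2
    rw [← h2]
    refine mul_nonneg (by linarith) (binEntropy_nonneg ?_ ?_)
    · exact div_nonneg hδ0 (by linarith)
    · exact div_le_one_of_le₀ (by linarith) (by linarith)
  have h3 : binEntropy (μ + δ) ≤ log 2 := binEntropy_le_log_two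
  rw [expE_eq hμ hδ0 hδ1, expF] at h
  have h4 := mul_nonneg_of_nonpos_of_nonpos (by linarith : 6 * μ - 2 ≤ 0) log_two_div_pi_neg.le
  linarith

/-- The optimal exponential tilt `y ^ 2 = δ / (1 - 2 μ - δ)` turns the generating function bound into
the entropy; for `δ = 0` it is approached as `y → 0`. -/
theorem exists_tilt {μ δ : ℝ} (hμ : 0 ≤ μ) (hδ0 : 0 ≤ δ) (hδ1 : δ ≤ 1 / 2 - μ) {s : ℝ}
    (hs : 0 < s) :
    ∃ y : ℝ, 0 < y ∧ y ≤ 1 ∧ -(2 * δ * log y) + (1 - 2 * μ) * log (1 + y ^ 2)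
      ≤ negMulLog δ + negMulLog (1 - 2 * μ - δ) - negMulLog (1 - 2 * μ) + s := by
  suffices h : ∃ z : ℝ, 0 < z ∧ z ≤ 1 ∧ -(δ * log z) + (1 - 2 * μ) * log (1 + z)
      ≤ negMulLog δ + negMulLog (1 - 2 * μ - δ) - negMulLog (1 - 2 * μ) + s by
    obtain ⟨z, hz0, hz1, hz⟩ := h
    refine ⟨√z, sqrt_pos.2 hz0, sqrt_le_one.2 hz1, ?_⟩
    rw [sq_sqrt hz0.le, log_sqrt hz0.le]
    linarith
  rcases eq_or_lt_of_le hδ0 with h0 | h0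
  · refine ⟨min 1 s, by positivity, min_le_left _ _, ?_⟩
    rw [← h0]
    have h1 : log (1 + min 1 s) ≤ min 1 s := by
      have := log_le_sub_one_of_pos (x := 1 + min 1 s) (by positivity)
      linarith
    have h2 : 0 ≤ log (1 + min 1 s) := log_nonneg (by have : 0 < min 1 s := by positivity
                                                      linarith)
    have h3 : min 1 s ≤ s := min_le_right _ _
    have h4 : (1 - 2 * μ) * log (1 + min 1 s) ≤ 1 * log (1 + min 1 s) :=
      mul_le_mul_of_nonneg_right (by linarith) h2
    simp
    linarith
  · have hc : 0 < 1 - 2 * μ - δ := by linarith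
    have h1 : 0 < 1 - 2 * μ := by linarith
    refine ⟨δ / (1 - 2 * μ - δ), by positivity, (div_le_one hc).2 (by linarith), ?_⟩
    have e : 1 + δ / (1 - 2 * μ - δ) = (1 - 2 * μ) / (1 - 2 * μ - δ) := by field_simp; ring
    rw [e, log_div h0.ne' hc.ne', log_div h1.ne' hc.ne']
    simp only [negMulLog]
    linarith

end Entropy

/-! ### The central estimate for binomial coefficients -/

section Binomial

open Finset

/-- The largest of the `m + 1` binomial probabilities is the one at `⌊(m + 1) α⌋`. -/
theorem one_le_mul_binomial_mode (m : ℕ) {α : ℝ} (h0 : 0 < α) (h1 : α < 1) :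
    1 ≤ (m + 1) * ((m.choose ⌊(m + 1) * α⌋₊ : ℝ) * α ^ ⌊(m + 1) * α⌋₊
      * (1 - α) ^ (m - ⌊(m + 1) * α⌋₊)) := by
  set l := ⌊(m + 1) * α⌋₊ with hl
  set t : ℕ → ℝ := fun k => (m.choose k : ℝ) * α ^ k * (1 - α) ^ (m - k) with ht
  have hpos : 0 ≤ ((m : ℝ) + 1) * α := by positivity
  have hα : 0 < 1 - α := by linarith
  have ht0 : ∀ k, 0 ≤ t k := fun k => by positivity
  have hrec : ∀ k, k < m → t (k + 1) * ((k + 1) * (1 - α)) = t k * ((m - k) * α) := by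
    intro k hk
    have h2 : (m.choose (k + 1) : ℝ) * (k + 1) = m.choose k * (m - k) := by
      have := Nat.choose_succ_right_eq m k
      have h3 : ((m.choose (k + 1) * (k + 1) : ℕ) : ℝ) = ((m.choose k * (m - k) : ℕ) : ℝ) := by
        rw [this]
      push_cast [Nat.cast_sub hk.le] at h3
      exact h3
    have h3 : m - k = (m - (k + 1)) + 1 := by omega
    simp only [ht]
    rw [h3, pow_succ, pow_succ]
    linear_combination (α ^ k * α * (1 - α) ^ (m - (k + 1)) * (1 - α)) * h2
  have hup : ∀ d, d ≤ l → t (l - d) ≤ t l := by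
    intro d
    induction d with
    | zero => intro _; simp
    | succ d ih =>
      intro hd
      refine le_trans ?_ (ih (by omega))
      set k := l - (d + 1) with hk
      have hk1 : l - d = k + 1 := by omega
      rw [hk1]
      have hkl : ((k + 1 : ℕ) : ℝ) ≤ (m + 1) * α := by
        refine le_trans ?_ (Nat.floor_le hpos)
        exact Nat.cast_le.2 (by omega : k + 1 ≤ l)
      push_cast at hkl
      have hkm : k < m := by
        have : (k : ℝ) < m := by nlinarith
        exact_mod_cast this
      have h2 := hrec k hkm
      have hkm' : (0 : ℝ) < m - k := by
        have : (k : ℝ) < m := by exact_mod_cast hkm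
        linarith
      have h3 : 0 < ((k : ℝ) + 1) * (1 - α) := by positivity
      have h4 : ((k : ℝ) + 1) * (1 - α) ≤ (m - k) * α := by linarith
      refine le_of_mul_le_mul_right ?_ h3
      rw [h2]
      exact mul_le_mul_of_nonneg_left h4 (ht0 k)
  have hdown : ∀ d, t (l + d) ≤ t l := by
    intro d
    induction d with
    | zero => simp
    | succ d ih =>
      refine le_trans ?_ ih
      rw [← add_assoc]
      set k := l + d with hk
      by_cases hkm : k < m
      · have h2 := hrec k hkm
        have hkl : (m + 1) * α ≤ k + 1 := by
          refine (Nat.lt_floor_add_one ((m + 1) * α)).le.trans ?_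
          have : (l : ℝ) ≤ k := by exact_mod_cast (by omega : l ≤ k)
          linarith
        have h3 : 0 < ((k : ℝ) + 1) * (1 - α) := by positivity
        have h4 : (m - k) * α ≤ ((k : ℝ) + 1) * (1 - α) := by linarith
        refine le_of_mul_le_mul_right ?_ h3
        rw [h2]
        exact mul_le_mul_of_nonneg_left h4 (ht0 k)
      · have : t (k + 1) = 0 := by
          simp only [ht]; rw [Nat.choose_eq_zero_of_lt (by omega)]; simp
        rw [this]; exact ht0 k
  have hle : ∀ k, t k ≤ t l := by
    intro k
    rcases le_total k l with h | h
    · have := hup (l - k) (by omega)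
      rwa [Nat.sub_sub_self h] at this
    · have := hdown (k - l)
      rwa [Nat.add_sub_cancel' h] at this
  have hsum : ∑ k ∈ range (m + 1), t k = 1 := by
    have := add_pow α (1 - α) m
    rw [add_sub_cancel, one_pow] at this
    rw [this]
    exact Finset.sum_congr rfl fun k _ => by simp only [ht]; ring
  calc (1 : ℝ) = ∑ k ∈ range (m + 1), t k := hsum.symm
    _ ≤ ∑ _k ∈ range (m + 1), t l := Finset.sum_le_sum fun k _ => hle k
    _ = (m + 1) * t l := by simp

theorem floor_succ_mul_le (m : ℕ) {α : ℝ} (h0 : 0 ≤ α) (h1 : α ≤ 1) :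
    ((⌊(m + 1) * α⌋₊ : ℕ) : ℝ) ≤ m * α + 1 := by
  refine (Nat.floor_le (by positivity)).trans ?_
  linarith

/-- The binomial coefficient at `⌊(m + 1) α⌋` is `exp (m H(α))` up to a factor of order `m`. -/
theorem exp_binEntropy_le_choose (m : ℕ) {α : ℝ} (h0 : 0 < α) (h1 : α ≤ 1 / 2) :
    Real.exp (m * Real.binEntropy α)
      ≤ (1 - α) / α * ((m + 1) * (m.choose ⌊(m + 1) * α⌋₊ : ℝ)) := by
  have hmode := one_le_mul_binomial_mode m h0 (by linarith)
  set l := ⌊(m + 1) * α⌋₊ with hl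
  have hα : 0 < 1 - α := by linarith
  have hlm : l ≤ m := by
    have h2 : (l : ℝ) < m + 1 := by
      refine (Nat.floor_le (by positivity)).trans_lt ?_
      nlinarith
    have : l < m + 1 := by exact_mod_cast h2
    omega
  have hlow : (m : ℝ) * α - 1 ≤ l := by
    have := Nat.lt_floor_add_one ((m + 1) * α)
    rw [← hl] at this
    linarith
  have hlog : Real.log α ≤ Real.log (1 - α) := Real.log_le_log h0 (by linarith)
  have hexp : Real.exp (m * Real.binEntropy α) * (α ^ l * (1 - α) ^ (m - l)) ≤ (1 - α) / α := by
    have e1 : α ^ l = Real.exp (l * Real.log α) := by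
      rw [Real.exp_nat_mul, Real.exp_log h0]
    have e2 : (1 - α) ^ (m - l) = Real.exp ((m - l : ℝ) * Real.log (1 - α)) := by
      rw [← Nat.cast_sub hlm, Real.exp_nat_mul, Real.exp_log hα]
    have e3 : (1 - α) / α = Real.exp (Real.log (1 - α) - Real.log α) := by
      rw [Real.exp_sub, Real.exp_log h0, Real.exp_log hα]
    rw [e1, e2, e3, ← Real.exp_add, ← Real.exp_add, Real.exp_le_exp,
      Real.binEntropy_eq_negMulLog_add_negMulLog_one_sub]
    simp only [Real.negMulLog]
    nlinarith
  calc Real.exp (m * Real.binEntropy α)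
      = Real.exp (m * Real.binEntropy α) * 1 := by rw [mul_one]
    _ ≤ Real.exp (m * Real.binEntropy α) *
        ((m + 1) * ((m.choose l : ℝ) * α ^ l * (1 - α) ^ (m - l))) :=
        mul_le_mul_of_nonneg_left hmode (Real.exp_pos _).le
    _ = (Real.exp (m * Real.binEntropy α) * (α ^ l * (1 - α) ^ (m - l)))
        * ((m + 1) * (m.choose l : ℝ)) := by ring
    _ ≤ _ := mul_le_mul_of_nonneg_right hexp (by positivity)

end Binomial

/-! ### Layer weights of the test polynomial -/

section Window

open Finset

/-- The layer weights of the test polynomial: the `W + 1` layers `l - W, …, l`, each normalised to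
have unit `L²` norm under the uniform measure on the cube. -/
noncomputable def layerWeight (m l W j : ℕ) : ℝ :=
  if l ≤ j + W ∧ j ≤ l then (√(m.choose j : ℝ))⁻¹ else 0

theorem layerWeight_nonneg (m l W j : ℕ) : 0 ≤ layerWeight m l W j := by
  rw [layerWeight]; split_ifs <;> positivity

theorem choose_le_choose_mul_pow (m j d : ℕ) :
    m.choose (j + d) ≤ m.choose j * m ^ d := by
  induction d with
  | zero => simp
  | succ d ih =>
    have h1 := Nat.choose_succ_right_eq m (j + d)
    have h2 : m.choose (j + d + 1) ≤ m.choose (j + d) * m := by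
      calc m.choose (j + d + 1) ≤ m.choose (j + d + 1) * (j + d + 1) :=
            Nat.le_mul_of_pos_right _ (by omega)
        _ = m.choose (j + d) * (m - (j + d)) := h1
        _ ≤ _ := Nat.mul_le_mul_left _ (Nat.sub_le _ _)
    calc m.choose (j + (d + 1)) = m.choose (j + d + 1) := by rw [add_assoc]
      _ ≤ m.choose (j + d) * m := h2
      _ ≤ m.choose j * m ^ d * m := Nat.mul_le_mul_right _ ih
      _ = _ := by ring

theorem layerWeight_le {m l W : ℕ} (hm : 1 ≤ m) (hl : l ≤ m) {y : ℝ} (hy0 : 0 < y) (hy1 : y ≤ 1)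
    (j : ℕ) :
    layerWeight m l W j ≤ (y ^ l)⁻¹ * √((m : ℝ) ^ W / m.choose l) * y ^ j := by
  rw [layerWeight]
  split_ifs with h
  · have hcl : (0 : ℝ) < m.choose l := by exact_mod_cast Nat.choose_pos hl
    have hcj : (0 : ℝ) < m.choose j := by exact_mod_cast Nat.choose_pos (h.2.trans hl)
    have h1 : (√(m.choose j : ℝ))⁻¹ ≤ √((m : ℝ) ^ W / m.choose l) := by
      rw [← Real.sqrt_inv]
      refine Real.sqrt_le_sqrt ?_
      rw [inv_eq_one_div, div_le_div_iff₀ hcj hcl, one_mul]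
      have h2 := choose_le_choose_mul_pow m j (l - j)
      rw [Nat.add_sub_cancel' h.2] at h2
      have h3 : m ^ (l - j) ≤ m ^ W := Nat.pow_le_pow_right hm (by omega)
      have h4 : m.choose l ≤ m ^ W * m.choose j := by
        rw [mul_comm]; exact h2.trans (Nat.mul_le_mul_left _ h3)
      exact_mod_cast h4
    have h5 : 1 ≤ (y ^ l)⁻¹ * y ^ j := by
      rw [inv_mul_eq_div, one_le_div (by positivity)]
      exact pow_le_pow_of_le_one hy0.le hy1 h.2
    calc (√(m.choose j : ℝ))⁻¹ ≤ √((m : ℝ) ^ W / m.choose l) * 1 := by rw [mul_one]; exact h1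
      _ ≤ √((m : ℝ) ^ W / m.choose l) * ((y ^ l)⁻¹ * y ^ j) :=
          mul_le_mul_of_nonneg_left h5 (Real.sqrt_nonneg _)
      _ = _ := by ring
  · positivity

theorem sqCoeff_layerWeight_empty {m l W : ℕ} (hl : l ≤ m) (hW : W ≤ l) :
    sqCoeff (layerWeight m l W) (∅ : Finset (Fin m)) = W + 1 := by
  rw [sqCoeff_empty, Fintype.card_fin]
  have h1 : ∀ j ∈ range (m + 1), (m.choose j : ℝ) * layerWeight m l W j ^ 2
      = if j ∈ Icc (l - W) l then 1 else 0 := by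
    intro j hj
    have hjm : j ≤ m := by have := mem_range.1 hj; omega
    have hcj : (0 : ℝ) < m.choose j := by exact_mod_cast Nat.choose_pos hjm
    rw [layerWeight]
    by_cases h : l ≤ j + W ∧ j ≤ l
    · have h' : j ∈ Icc (l - W) l := mem_Icc.2 ⟨by omega, h.2⟩
      rw [if_pos h, if_pos h', inv_pow, Real.sq_sqrt hcj.le, mul_inv_cancel₀ hcj.ne']
    · have h' : j ∉ Icc (l - W) l := fun h2 =>
        h ⟨by have := (mem_Icc.1 h2).1; omega, (mem_Icc.1 h2).2⟩
      rw [if_neg h, if_neg h']; simp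
  rw [Finset.sum_congr rfl h1, Finset.sum_ite_mem,
    Finset.inter_eq_right.2 (fun j hj => by have := (mem_Icc.1 hj).2; exact mem_range.2 (by omega))]
  rw [Finset.sum_const, Nat.card_Icc, nsmul_eq_mul, mul_one]
  have : l + 1 - (l - W) = W + 1 := by omega
  rw [this]; push_cast; ring

theorem le_sum_sqCoeff_layerWeight_singleton {m l W : ℕ} (hl : l ≤ m) (hW : W ≤ l) :
    2 * (W * √(((m : ℝ) - l) * ((l : ℝ) - W)))
      ≤ ∑ i, sqCoeff (layerWeight m l W) ({i} : Finset (Fin m)) := by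
  rw [sum_sqCoeff_singleton, Fintype.card_fin]
  refine mul_le_mul_of_nonneg_left ?_ (by norm_num)
  have hnn : ∀ j ∈ range (m + 1), 0 ≤ (m.choose j : ℝ) * (((m : ℝ) - j)
      * (layerWeight m l W j * layerWeight m l W (j + 1))) := by
    intro j hj
    have : (j : ℝ) ≤ m := by exact_mod_cast (by have := mem_range.1 hj; omega : j ≤ m)
    have h1 := layerWeight_nonneg m l W j
    have h2 := layerWeight_nonneg m l W (j + 1)
    have h3 : 0 ≤ (m : ℝ) - j := by linarith
    positivity
  have hsub : Ico (l - W) l ⊆ range (m + 1) := fun j hj =>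
    mem_range.2 (by have := (mem_Ico.1 hj).2; omega)
  refine le_trans ?_ (Finset.sum_le_sum_of_subset_of_nonneg hsub fun j hj _ => hnn j hj)
  have hcard : (Ico (l - W) l).card = W := by rw [Nat.card_Ico]; omega
  have : (W : ℝ) * √(((m : ℝ) - l) * ((l : ℝ) - W))
      = ∑ _j ∈ Ico (l - W) l, √(((m : ℝ) - l) * ((l : ℝ) - W)) := by
    rw [Finset.sum_const, hcard, nsmul_eq_mul]
  rw [this]
  refine Finset.sum_le_sum fun j hj => ?_
  obtain ⟨hj1, hj2⟩ := mem_Ico.1 hj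
  have hc1 : (0 : ℝ) < m.choose j := by exact_mod_cast Nat.choose_pos (by omega : j ≤ m)
  have hc2 : (0 : ℝ) < m.choose (j + 1) := by exact_mod_cast Nat.choose_pos (by omega : j + 1 ≤ m)
  have hw1 : layerWeight m l W j = (√(m.choose j : ℝ))⁻¹ := if_pos ⟨by omega, by omega⟩
  have hw2 : layerWeight m l W (j + 1) = (√(m.choose (j + 1) : ℝ))⁻¹ := if_pos ⟨by omega, by omega⟩
  have hrec : (m.choose (j + 1) : ℝ) * (j + 1) = m.choose j * (m - j) := by
    have := Nat.choose_succ_right_eq m j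
    have h3 : ((m.choose (j + 1) * (j + 1) : ℕ) : ℝ) = ((m.choose j * (m - j) : ℕ) : ℝ) := by
      rw [this]
    push_cast [Nat.cast_sub (by omega : j ≤ m)] at h3
    exact h3
  have hjl : (j : ℝ) + 1 ≤ l := by exact_mod_cast (by omega : j + 1 ≤ l)
  have hlm : (l : ℝ) ≤ m := by exact_mod_cast hl
  have hlW : (l : ℝ) - W ≤ j := by
    have : (l : ℝ) ≤ j + W := by exact_mod_cast (by omega : l ≤ j + W)
    linarith
  have hmj : (0 : ℝ) < m - j := by linarith
  rw [hw1, hw2]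
  refine Real.sqrt_le_iff.2 ⟨by positivity, ?_⟩
  have hsq : ((m.choose j : ℝ) * (((m : ℝ) - j)
      * ((√(m.choose j : ℝ))⁻¹ * (√(m.choose (j + 1) : ℝ))⁻¹))) ^ 2 = (m - j) * (j + 1) := by
    rw [mul_pow, mul_pow, mul_pow, inv_pow, inv_pow, Real.sq_sqrt hc1.le, Real.sq_sqrt hc2.le]
    field_simp
    linear_combination (-1 : ℝ) * hrec
  rw [hsq]
  have hW' : (0:ℝ) ≤ (l : ℝ) - W := by
    have : (W : ℝ) ≤ l := by exact_mod_cast hW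
    linarith
  exact mul_le_mul (by linarith) (by linarith) hW' hmj.le

end Window

/-! ### Asymptotics -/

section Asymptotics

open Filter Topology

/-- The error term of the moment inequality for the layer weights is at most a polynomial times the
exponential of the exponent. -/
theorem error_le {m n W : ℕ} {μ α y g : ℝ} (hn : (n : ℝ) = 2 * μ * m) (hnm : n ≤ m)
    (hmn : 2 * m ≤ 3 * n) (hα0 : 0 < α) (hα1 : α ≤ 1 / 2) (hy0 : 0 < y) (hy1 : y ≤ 1)
    (hg : 0 < g) (hl : ⌊(m + 1) * α⌋₊ ≤ m) :
    ((y ^ ⌊(m + 1) * α⌋₊)⁻¹ * √((m : ℝ) ^ W / m.choose ⌊(m + 1) * α⌋₊)) ^ 2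
        * ((1 + y ^ 2) ^ m * (2 * y / (1 + y ^ 2)) ^ n) * (2 ^ (m - n) * g ^ (3 * n - 2 * m))
      ≤ (y ^ 2)⁻¹ * ((1 - α) / α) * (m + 1) ^ (W + 1) * Real.exp (m *
        (-(2 * α * Real.log y) + Real.log (1 + y ^ 2)
          + 2 * μ * (Real.log 2 + Real.log y - Real.log (1 + y ^ 2))
          - Real.binEntropy α + (1 - 2 * μ) * Real.log 2 + (6 * μ - 2) * Real.log g)) := by
  have hmode := exp_binEntropy_le_choose m hα0 hα1
  have hlfl := floor_succ_mul_le m hα0.le (by linarith : α ≤ 1)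
  set l := ⌊(m + 1) * α⌋₊ with hldef
  have hc : (0 : ℝ) < m.choose l := by exact_mod_cast Nat.choose_pos hl
  have hly : Real.log y ≤ 0 := Real.log_nonpos hy0.le hy1
  have h1y : (0 : ℝ) < 1 + y ^ 2 := by positivity
  have hα2 : 0 < (1 - α) / α := div_pos (by linarith) hα0
  have e1 : ((y ^ l)⁻¹) ^ 2 ≤ (y ^ 2)⁻¹ * Real.exp (m * (-(2 * α * Real.log y))) := by
    have a1 : ((y ^ l)⁻¹) ^ 2 = Real.exp (-(2 * l * Real.log y)) := by
      rw [Real.exp_neg, mul_comm 2 (l : ℝ), mul_assoc, Real.exp_nat_mul, two_mul, Real.exp_add,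
        Real.exp_log hy0, inv_pow, ← pow_mul, mul_comm l 2, pow_mul, sq]
    have a2 : (y ^ 2)⁻¹ = Real.exp (-(2 * Real.log y)) := by
      rw [Real.exp_neg, two_mul, Real.exp_add, Real.exp_log hy0, sq]
    rw [a1, a2, ← Real.exp_add, Real.exp_le_exp]
    nlinarith
  have e2 : (m : ℝ) ^ W / m.choose l
      ≤ (1 - α) / α * (m + 1) ^ (W + 1) * Real.exp (m * (-Real.binEntropy α)) := by
    rw [mul_neg, Real.exp_neg, ← div_eq_mul_inv, div_le_div_iff₀ hc (Real.exp_pos _)]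
    calc (m : ℝ) ^ W * Real.exp (m * Real.binEntropy α)
        ≤ (m + 1) ^ W * ((1 - α) / α * ((m + 1) * (m.choose l : ℝ))) := by
          refine mul_le_mul ?_ hmode (Real.exp_pos _).le (by positivity)
          exact pow_le_pow_left₀ (by positivity) (by linarith) _
      _ = _ := by ring
  have e3 : (1 + y ^ 2) ^ m = Real.exp (m * Real.log (1 + y ^ 2)) := by
    rw [Real.exp_nat_mul, Real.exp_log h1y]
  have e4 : (2 * y / (1 + y ^ 2)) ^ n
      = Real.exp (m * (2 * μ * (Real.log 2 + Real.log y - Real.log (1 + y ^ 2)))) := by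
    have : (m : ℝ) * (2 * μ * (Real.log 2 + Real.log y - Real.log (1 + y ^ 2)))
        = n * Real.log (2 * y / (1 + y ^ 2)) := by
      rw [Real.log_div (by positivity) h1y.ne', Real.log_mul (by norm_num) hy0.ne', hn]; ring
    rw [this, Real.exp_nat_mul, Real.exp_log (by positivity)]
  have e5 : (2 : ℝ) ^ (m - n) = Real.exp (m * ((1 - 2 * μ) * Real.log 2)) := by
    have : (m : ℝ) * ((1 - 2 * μ) * Real.log 2) = ((m - n : ℕ) : ℝ) * Real.log 2 := by
      rw [Nat.cast_sub hnm, hn]; ring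
    rw [this, Real.exp_nat_mul, Real.exp_log (by norm_num)]
  have e6 : g ^ (3 * n - 2 * m) = Real.exp (m * ((6 * μ - 2) * Real.log g)) := by
    have : (m : ℝ) * ((6 * μ - 2) * Real.log g) = ((3 * n - 2 * m : ℕ) : ℝ) * Real.log g := by
      rw [Nat.cast_sub hmn]; push_cast; rw [hn]; ring
    rw [this, Real.exp_nat_mul, Real.exp_log hg]
  rw [mul_pow, Real.sq_sqrt (by positivity), e3, e4, e5, e6]
  calc _ ≤ ((y ^ 2)⁻¹ * Real.exp (m * (-(2 * α * Real.log y)))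
        * ((1 - α) / α * (m + 1) ^ (W + 1) * Real.exp (m * (-Real.binEntropy α))))
        * (Real.exp (m * Real.log (1 + y ^ 2))
          * Real.exp (m * (2 * μ * (Real.log 2 + Real.log y - Real.log (1 + y ^ 2)))))
        * (Real.exp (m * ((1 - 2 * μ) * Real.log 2))
          * Real.exp (m * ((6 * μ - 2) * Real.log g))) := by
        gcongr
    _ = (y ^ 2)⁻¹ * ((1 - α) / α) * (m + 1) ^ (W + 1) *
        (Real.exp (m * (-(2 * α * Real.log y))) * Real.exp (m * Real.log (1 + y ^ 2))
          * Real.exp (m * (2 * μ * (Real.log 2 + Real.log y - Real.log (1 + y ^ 2))))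
          * Real.exp (m * (-Real.binEntropy α)) * Real.exp (m * ((1 - 2 * μ) * Real.log 2))
          * Real.exp (m * ((6 * μ - 2) * Real.log g))) := by ring
    _ = _ := by
        simp only [← Real.exp_add]
        congr 2
        ring

theorem scl_half {α : ℝ} (h0 : 0 ≤ α) (h1 : α ≤ 1 / 2) :
    scl (1 / 2) α = 1 / 2 + √(α * (1 - α)) := by
  have h2 : 0 ≤ 1 - α := by linarith
  rw [scl, if_pos (by linarith), add_sq, Real.sq_sqrt (by positivity),
    Real.sq_sqrt (by positivity), mul_assoc, ← Real.sqrt_mul (by positivity)]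
  have : α * (1 - 1 / 2) * (1 / 2 * (1 - α)) = α * (1 - α) * (1 / 2) ^ 2 := by ring
  rw [this, Real.sqrt_mul (by positivity), Real.sqrt_sq (by norm_num)]
  ring

theorem tendsto_succ_pow_mul_exp_neg {c : ℝ} (hc : 0 < c) (d : ℕ) :
    Tendsto (fun m : ℕ => ((m : ℝ) + 1) ^ d * Real.exp (m * -c)) atTop (𝓝 0) := by
  have h1 : |Real.exp (-c)| < 1 := by
    rw [abs_of_pos (Real.exp_pos _)]
    exact Real.exp_lt_one_iff.2 (by linarith)
  have h2 := (tendsto_add_atTop_iff_nat 1).2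
    (tendsto_pow_const_mul_const_pow_of_abs_lt_one d h1)
  have h3 := h2.mul_const (Real.exp c)
  rw [zero_mul] at h3
  refine h3.congr fun m => ?_
  rw [← Real.exp_nat_mul, mul_assoc, ← Real.exp_add]
  push_cast
  congr 2
  ring

set_option maxHeartbeats 1000000 in
/-- The moment inequality contradicts a satisfaction ratio below `scl - ε`: after division by `m` its
main terms give `W β ≤ (β - ε) (W + 1)` up to `3 / 4`, where `β = 2 √(α (1 - α))`, which fails once
`ε (W + 1) ≥ 3`. -/
theorem balancedSolvable_scl {μ δ : ℝ} (hμ0 : 0 ≤ 2 * μ) (hμ1 : 2 * μ ≤ 1) (hδ0 : 0 ≤ δ)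
    (hδ1 : δ ≤ 1 / 2 - μ) (hEF : expE μ δ + expF μ < 0) :
    BalancedSolvable μ (scl (1 / 2) (μ + δ)) := by
  intro ε hε
  have hμ : 0 ≤ μ := by linarith
  have h6 : 2 < 6 * μ := two_lt_of_exponent_neg hμ hδ0 hδ1 hEF
  set α : ℝ := μ + δ with hα
  have hα0 : 0 < α := by linarith
  have hα1 : α ≤ 1 / 2 := by linarith
  -- A third of the slack in the exponent is left after approximating the tilt and the bound `2 / π`.
  set c : ℝ := -(expE μ δ + expF μ) / 3 with hc
  have hc0 : 0 < c := by linarith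
  obtain ⟨y, hy0, hy1, hy⟩ := exists_tilt hμ hδ0 hδ1 hc0
  set g : ℝ := min 1 (2 / Real.pi * Real.exp c) with hg
  have hpi : (0 : ℝ) < 2 / Real.pi := by positivity
  have hg0 : 0 < g := by positivity
  have hg1 : g ≤ 1 := min_le_left _ _
  have hg2 : 2 / Real.pi < g := by
    refine lt_min ?_ ?_
    · rw [div_lt_one Real.pi_pos]; linarith [Real.pi_gt_three]
    · have := Real.one_lt_exp_iff.2 hc0
      nlinarith
  have hlogg : Real.log g ≤ Real.log (2 / Real.pi) + c := by
    have h1 := Real.log_le_log hg0 (min_le_right 1 (2 / Real.pi * Real.exp c))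
    rwa [Real.log_mul hpi.ne' (Real.exp_ne_zero _), Real.log_exp] at h1
  have hexpo : -(2 * α * Real.log y) + Real.log (1 + y ^ 2)
      + 2 * μ * (Real.log 2 + Real.log y - Real.log (1 + y ^ 2))
      - Real.binEntropy α + (1 - 2 * μ) * Real.log 2 + (6 * μ - 2) * Real.log g ≤ -c := by
    have hE := expE_eq hμ hδ0 hδ1
    have h1 : (6 * μ - 2) * Real.log g ≤ (6 * μ - 2) * Real.log (2 / Real.pi) + c := by
      have := mul_le_mul_of_nonneg_left hlogg (by linarith : 0 ≤ 6 * μ - 2)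
      nlinarith
    rw [expF] at hc
    rw [← hα] at hE
    have h2 : -(2 * α * Real.log y) = -(2 * δ * Real.log y) - 2 * μ * Real.log y := by
      rw [hα]; ring
    linarith
  set β : ℝ := 2 * √(α * (1 - α)) with hβ
  have hβ0 : 0 ≤ β := by positivity
  have hβ1 : β ≤ 1 := by
    have : √(α * (1 - α)) ≤ 1 / 2 :=
      Real.sqrt_le_iff.2 ⟨by norm_num, by nlinarith [sq_nonneg (α - 1 / 2)]⟩
    linarith
  have hscl : scl (1 / 2) α = 1 / 2 + β / 2 := by
    rw [scl_half hα0.le hα1, hβ]; ring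
  obtain ⟨W, hW⟩ := exists_nat_ge (3 / ε)
  have hWε : 3 ≤ ε * (W + 1) := by
    rw [div_le_iff₀ hε] at hW
    linarith
  -- The density tolerance makes the tail bound `τ ^ (ε m / 4)` with `τ = 2 η` at most `8 ^ (-m)`,
  -- which beats the factor `2 ^ m * 2 ^ m` from the sup norm and the tail estimate.
  obtain ⟨K, hK⟩ := exists_nat_ge (4 / ε)
  have hKε : 4 ≤ K * ε := by rwa [div_le_iff₀ hε] at hK
  set η : ℝ := (1 / 8 : ℝ) ^ K / 2 with hη
  have hη0 : 0 < η := by positivity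
  have h2η : 2 * η = (1 / 8 : ℝ) ^ K := by rw [hη]; ring
  set A : ℝ := (y ^ 2)⁻¹ * ((1 - α) / α) with hA
  have hA0 : 0 ≤ A := mul_nonneg (by positivity) (div_nonneg (by linarith) hα0.le)
  have ev1 : ∀ᶠ m : ℕ in atTop, 2 * μ < 1 → 2 ≤ (1 - 2 * μ) * m := by
    by_cases h : 2 * μ < 1
    · have := (tendsto_natCast_atTop_atTop (R := ℝ)).const_mul_atTop (by linarith : 0 < 1 - 2 * μ)
      filter_upwards [this.eventually_ge_atTop 2] with m hm _ using hm
    · exact Eventually.of_forall fun m h' => absurd h' h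
  have ev2 : ∀ᶠ m : ℕ in atTop, 4 * Real.pi / (2 * μ * m) ≤ g - 2 / Real.pi := by
    have h1 := (tendsto_natCast_atTop_atTop (R := ℝ)).const_mul_atTop (by linarith : 0 < 2 * μ)
    exact (h1.const_div_atTop (4 * Real.pi)).eventually_le_const (by linarith)
  have ev3 : ∀ᶠ m : ℕ in atTop, (W : ℝ) + 1 ≤ α * m :=
    ((tendsto_natCast_atTop_atTop (R := ℝ)).const_mul_atTop hα0).eventually_ge_atTop _
  have ev4 : ∀ᶠ m : ℕ in atTop, (4 : ℝ) ≤ ε * m :=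
    ((tendsto_natCast_atTop_atTop (R := ℝ)).const_mul_atTop hε).eventually_ge_atTop _
  have ev5 : ∀ᶠ m : ℕ in atTop,
      (2 + ε) * A * (((m : ℝ) + 1) ^ (W + 1) * Real.exp (m * -c)) ≤ 1 / 4 := by
    have := (tendsto_succ_pow_mul_exp_neg hc0 (W + 1)).const_mul ((2 + ε) * A)
    rw [mul_zero] at this
    exact this.eventually_le_const (by norm_num)
  have ev6 : ∀ᶠ m : ℕ in atTop, (1 + ε) * (W + 1) * (1 / 2 : ℝ) ^ m ≤ 1 / 4 := by
    have := (tendsto_pow_atTop_nhds_zero_of_lt_one (r := (1 / 2 : ℝ)) (by norm_num)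
      (by norm_num)).const_mul ((1 + ε) * (W + 1))
    rw [mul_zero] at this
    exact this.eventually_le_const (by norm_num)
  have ev7 : ∀ᶠ m : ℕ in atTop,
      W * β - 1 / 4 ≤ 2 * (W * √((1 - α - 1 / m) * (α - (W + 1) / m))) := by
    have h1 : Tendsto (fun m : ℕ => (1 : ℝ) / m) atTop (𝓝 0) :=
      tendsto_const_div_atTop_nhds_zero_nat 1
    have h2 : Tendsto (fun m : ℕ => ((W : ℝ) + 1) / m) atTop (𝓝 0) :=
      tendsto_const_div_atTop_nhds_zero_nat _
    have h3 := ((h1.const_sub (1 - α)).mul (h2.const_sub α)).sqrt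
    have h4 := (h3.const_mul (W : ℝ)).const_mul 2
    refine h4.eventually_const_le ?_
    rw [sub_zero, sub_zero, mul_comm (1 - α) α, hβ]
    linarith
  obtain ⟨M, hM⟩ := eventually_atTop.1
    ((eventually_ge_atTop 2).and (ev1.and (ev2.and (ev3.and (ev4.and (ev5.and (ev6.and ev7)))))))
  refine ⟨η, hη0, M, fun m n p _ B S hMm hn hB hS => ?_⟩
  obtain ⟨hm2, h1, h2, h3, h4, h5, h6', h7⟩ := hM m hMm
  have hm0 : (0 : ℝ) < m := by exact_mod_cast (by omega : 0 < m)
  have hm2' : (2 : ℝ) ≤ m := by exact_mod_cast hm2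
  have hnm := hB.1
  have hmn : 2 * m ≤ 3 * n := by
    have : (2 : ℝ) * m ≤ 3 * n := by
      have := mul_le_mul_of_nonneg_right h6.le hm0.le
      rw [hn]; linarith
    exact_mod_cast this
  -- For large `m` the codimension `(1 - 2 μ) m` is either zero, when there is no nonzero dual word,
  -- or at least two, when `p > n`.
  have hne : m ≠ n + 1 := by
    intro h
    have hcast : (m : ℝ) = n + 1 := by exact_mod_cast h
    rcases lt_or_eq_of_le hμ1 with hlt | heq
    · have := h1 hlt
      linarith
    · rw [heq] at hn; linarith
  have hgp : n + 2 ≤ m → 2 / Real.pi + 4 * Real.pi / p ≤ g := by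
    intro h
    have hnp : (n : ℝ) < p := by exact_mod_cast hB.lt_prime h
    have hn0 : 0 < 2 * μ * (m : ℝ) := mul_pos (by linarith) hm0
    have : 4 * Real.pi / p ≤ 4 * Real.pi / (2 * μ * m) := by
      rw [← hn] at hn0 ⊢
      exact div_le_div_of_nonneg_left (by positivity) hn0 hnp.le
    linarith
  -- With `t` positive spins at violated constraints, the total spin is at most
  -- `(2 s(x) - 1) m + 2 t ≤ (β - 2 ε) m + 2 t`; the bound `t ≤ ε m / 2` brings this to `(β - ε) m`,
  -- and larger `t` are a rare event.
  by_contra hno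
  push Not at hno
  have hN : ∀ x : Fin n → ZMod p,
      ((Finset.univ.filter fun i : Fin m => B.mulVec x i ∈ S i).card : ℝ)
        ≤ (1 / 2 + β / 2 - ε) * m := by
    intro x
    have := hno x
    rw [satRatio, hscl, div_lt_iff₀ hm0] at this
    exact this.le
  set l := ⌊(m + 1) * α⌋₊ with hl
  have hlup := floor_succ_mul_le m hα0.le (by linarith : α ≤ 1)
  have hllow : (m : ℝ) * α - 1 ≤ l := by
    have := Nat.lt_floor_add_one (((m : ℝ) + 1) * α)
    rw [← hl] at this
    linarith
  rw [← hl] at hlup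
  have hlm : l ≤ m := by
    have : (l : ℝ) ≤ m := by
      have := mul_le_mul_of_nonneg_left hα1 hm0.le
      linarith
    exact_mod_cast this
  have hWl : W ≤ l := by
    have : (W : ℝ) ≤ l := by linarith
    exact_mod_cast this
  set s : ℕ := ⌈ε * m / 4⌉₊ with hs
  have hs1 : (s : ℝ) ≤ ε * m / 4 + 1 := (Nat.ceil_lt_add_one (by positivity)).le
  have hs2 : ε * m / 4 ≤ s := Nat.le_ceil _
  have hineq := hB.moment_inequality S hη0
    (by rw [h2η]; exact pow_le_one₀ (by norm_num) (by norm_num)) hS hg0.le hg1 hgp hne hmn hN s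
    (r := (β - ε) * m) (e := (1 + ε) * m) (by linarith) (by positivity)
    (by have := mul_nonneg hβ0 hm0.le; linarith)
    (layerWeight_nonneg m l W) hy0
    (layerWeight_le (by omega) hlm hy0 hy1)
  rw [sqCoeff_layerWeight_empty hlm hWl] at hineq
  have hmain := le_sum_sqCoeff_layerWeight_singleton hlm hWl
  have hlower : (W * β - 1 / 4) * m ≤ 2 * (W * √(((m : ℝ) - l) * ((l : ℝ) - W))) := by
    have hsq : √((1 - α - 1 / m) * (α - (W + 1) / m)) * m
        ≤ √(((m : ℝ) - l) * ((l : ℝ) - W)) := by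
      refine Real.le_sqrt_of_sq_le ?_
      have hp1 : 0 ≤ 1 - α - 1 / (m : ℝ) := by
        have : 1 / (m : ℝ) ≤ 1 / 2 := one_div_le_one_div_of_le (by norm_num) hm2'
        linarith
      have hp2 : 0 ≤ α - ((W : ℝ) + 1) / m := by
        rw [sub_nonneg, div_le_iff₀ hm0]; exact h3
      rw [mul_pow, Real.sq_sqrt (mul_nonneg hp1 hp2)]
      have e1 : (1 - α - 1 / (m : ℝ)) * (α - (W + 1) / m) * (m : ℝ) ^ 2
          = ((1 - α) * m - 1) * (α * m - (W + 1)) := by field_simp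
      rw [e1]
      have hlR : (l : ℝ) ≤ m := Nat.cast_le.2 hlm
      exact mul_le_mul (by linarith) (by linarith) (by linarith) (by linarith)
    have := mul_le_mul_of_nonneg_right h7 hm0.le
    have := mul_le_mul_of_nonneg_left hsq (by positivity : (0 : ℝ) ≤ 2 * W)
    linarith
  have herr := error_le (W := W) hn hnm hmn hα0 hα1 hy0 hy1 hg0 hlm
  have hexp : Real.exp (m * (-(2 * α * Real.log y) + Real.log (1 + y ^ 2)
      + 2 * μ * (Real.log 2 + Real.log y - Real.log (1 + y ^ 2))
      - Real.binEntropy α + (1 - 2 * μ) * Real.log 2 + (6 * μ - 2) * Real.log g))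
      ≤ Real.exp (m * -c) := Real.exp_le_exp.2 (mul_le_mul_of_nonneg_left hexpo hm0.le)
  rw [← hl, ← hA] at herr
  set X : ℝ := ((y ^ l)⁻¹ * √((m : ℝ) ^ W / m.choose l)) ^ 2
        * ((1 + y ^ 2) ^ m * (2 * y / (1 + y ^ 2)) ^ n) * (2 ^ (m - n) * g ^ (3 * n - 2 * m))
    with hX
  have hX0 : 0 ≤ X := by positivity
  have hX1 : X ≤ A * (((m : ℝ) + 1) ^ (W + 1) * Real.exp (m * -c)) := by
    refine herr.trans ?_
    rw [mul_assoc]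
    exact mul_le_mul_of_nonneg_left (mul_le_mul_of_nonneg_left hexp (by positivity)) hA0
  have hr : (m : ℝ) + |(β - ε) * m| ≤ (2 + ε) * m := by
    have : |(β - ε) * m| ≤ (1 + ε) * m := by
      rw [abs_mul, abs_of_pos hm0]
      exact mul_le_mul_of_nonneg_right (abs_le.2 ⟨by linarith, by linarith⟩) hm0.le
    linarith
  have hterm1 : ((m : ℝ) + |(β - ε) * m|) * X ≤ 1 / 4 * m := by
    calc ((m : ℝ) + |(β - ε) * m|) * X ≤ ((2 + ε) * m) * X := mul_le_mul_of_nonneg_right hr hX0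
      _ ≤ ((2 + ε) * m) * (A * (((m : ℝ) + 1) ^ (W + 1) * Real.exp (m * -c))) :=
          mul_le_mul_of_nonneg_left hX1 (by positivity)
      _ = (2 + ε) * A * (((m : ℝ) + 1) ^ (W + 1) * Real.exp (m * -c)) * m := by ring
      _ ≤ _ := mul_le_mul_of_nonneg_right h5 hm0.le
  have hterm2 : (1 + ε) * m * (2 ^ m * ((W : ℝ) + 1)) * (2 ^ m * (2 * η) ^ s) ≤ 1 / 4 * m := by
    have hKs : m ≤ K * s := by
      have : (m : ℝ) ≤ K * s := by
        have := mul_le_mul_of_nonneg_left hs2 (by positivity : (0 : ℝ) ≤ K)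
        have := mul_le_mul_of_nonneg_right hKε hm0.le
        linarith
      exact_mod_cast this
    have hpow : (2 : ℝ) ^ m * (2 ^ m * (2 * η) ^ s) ≤ (1 / 2) ^ m := by
      rw [h2η, ← pow_mul]
      calc (2 : ℝ) ^ m * (2 ^ m * (1 / 8) ^ (K * s)) ≤ 2 ^ m * (2 ^ m * (1 / 8) ^ m) := by
            have := pow_le_pow_of_le_one (by norm_num : (0 : ℝ) ≤ 1 / 8) (by norm_num) hKs
            gcongr
        _ = (1 / 2) ^ m := by rw [← mul_pow, ← mul_pow]; norm_num
    calc (1 + ε) * m * (2 ^ m * ((W : ℝ) + 1)) * (2 ^ m * (2 * η) ^ s)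
        = (1 + ε) * (W + 1) * (2 ^ m * (2 ^ m * (2 * η) ^ s)) * m := by ring
      _ ≤ (1 + ε) * (W + 1) * (1 / 2) ^ m * m := by gcongr
      _ ≤ _ := mul_le_mul_of_nonneg_right h6' hm0.le
  have hfinal : (W * β - 1 / 4) * m ≤ (β - ε) * m * (W + 1) + 1 / 4 * m + 1 / 4 * m := by
    linarith
  have hfinal' : W * β - 1 / 4 ≤ (β - ε) * (W + 1) + 1 / 4 + 1 / 4 := by
    refine le_of_mul_le_mul_right ?_ hm0
    linarith
  linarith

end Asymptotics

/-! ### The rate threshold -/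

section Threshold

theorem expE_half_sub (μ : ℝ) : expE μ (1 / 2 - μ) = 0 := by
  rw [expE]
  have e1 : μ + (1 / 2 - μ) = 1 / 2 := by ring
  have e2 : 1 - μ - (1 / 2 - μ) = 1 / 2 := by ring
  have e3 : μ / (1 / 2) = 2 * μ := by ring
  rw [e1, e2, e3]
  ring

/-- `F` is decreasing, and at `2 μ = 0.78` the inequality `F < 0` amounts to `2 ^ 28 < π ^ 17`. -/
theorem expF_neg {μ : ℝ} (h : (0.78 : ℝ) ≤ 2 * μ) : expF μ < 0 := by
  have hlog : 28 * Real.log 2 < 17 * Real.log Real.pi := by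
    have h1 : Real.log ((2 : ℝ) ^ 28) < Real.log (Real.pi ^ 17) := by
      refine Real.log_lt_log (by positivity) ?_
      calc (2 : ℝ) ^ 28 < 3.14 ^ 17 := by norm_num
        _ < Real.pi ^ 17 := pow_lt_pow_left₀ Real.pi_gt_d2 (by norm_num) (by norm_num)
    rw [Real.log_pow, Real.log_pow] at h1
    exact_mod_cast h1
  have h2 : 0 < Real.log 2 := Real.log_pos (by norm_num)
  have h3 : Real.log 2 < Real.log Real.pi :=
    Real.log_lt_log (by norm_num) (by linarith [Real.pi_gt_three])
  rw [expF, Real.log_div (by norm_num) Real.pi_ne_zero]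
  norm_num at h
  nlinarith

end Threshold

theorem theorem4 (μ : ℝ) (hμ0 : 0 ≤ 2 * μ) (hμ1 : 2 * μ ≤ 1) :
    (∀ δ : ℝ, 0 ≤ δ → δ ≤ 1 / 2 - μ → expE μ δ + expF μ < 0 →
      BalancedSolvable μ (scl (1 / 2) (μ + δ))) ∧
    ((0.78 : ℝ) ≤ 2 * μ → BalancedSolvable μ 1) := by
  refine ⟨fun δ hδ0 hδ1 h => balancedSolvable_scl hμ0 hμ1 hδ0 hδ1 h, fun h => ?_⟩
  have h1 := balancedSolvable_scl hμ0 hμ1 (δ := 1 / 2 - μ) (by linarith) le_rfl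
    (by rw [expE_half_sub, zero_add]; exact expF_neg h)
  have h2 : scl (1 / 2) (μ + (1 / 2 - μ)) = 1 := by
    rw [add_sub_cancel, scl_half (by norm_num) le_rfl]
    have : (1 / 2 : ℝ) * (1 - 1 / 2) = (1 / 2) ^ 2 := by norm_num
    rw [this, Real.sqrt_sq (by norm_num)]
    norm_num
  rwa [h2] at h1
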